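/- Let $\mathbf{Top}$ be a convenient category of spaces, i.e. a full subcategory of the category of topological spaces that is complete, cocomplete and cartesian closed and contains the unit interval $I=[0,1]$ (for instance $k$-spaces, or compactly generated weak Hausdorff spaces). Let $\mathcal C$ be a topologically bicomplete category, i.e. a (locally small) complete and cocomplete category which is enriched, tensored and cotensored over $\mathbf{Top}$. Write $i_0,i_1\colon X\to X\otimes I$ and $p_0,p_1\colon Y^I\to Y$ for the maps induced by the endpoint inclusions $*\rightrightarrows I$. Two maps $f_0,f_1\colon X\to Y$ are homotopic if there is $h\colon X\otimes I\to Y$ with $h i_0=f_0$ and $h i_1=f_1$; this defines the homotopy equivalences. A map is an $h$-fibration if it has the right lifting property with respect to $i_0\colon Z\to Z\otimes I$ for all objects $Z$, and a strong $h$-cofibration if it has the left lifting property with respect to all $h$-fibrations that are homotopy equivalences. For $f\colon X\to Y$, let the mapping path object $Nf$ be the pullback of $f$ and $p_0\colon Y^I\to Y$. Suppose that $\mathcal C$ satisfies the monomorphism hypothesis: there are an orthogonal factorization system $(\mathcal E,\mathcal M)$ on $\mathcal C$ (a weak factorization system with unique liftings) which is well-copowered (every object has, up to isomorphism, only a set of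 $\mathcal E$-quotients) and a regular cardinal $\alpha$ such that, for every object $Y$ and every $\alpha$-indexed sequence of arrows $f_\beta\colon X_\beta\to Y$ $(\beta<\alpha)$ over $Y$, with colimit $f_\alpha\colon X_\alpha=\mathrm{colim}_{\beta<\alpha}X_\beta\to Y$, if all the colimit legs $X_\beta\to X_\alpha$ lie in $\mathcal M$, then the natural map $\mathrm{colim}_{\beta<\alpha}\,Nf_\beta\to Nf_\alpha$ is an isomorphism. Then $\mathcal C$ admits a model structure whose weak equivalences are exactly the homotopy equivalences, whose fibrations are exactly the $h$-fibrations, and whose cofibrations are exactly the strong $h$-cofibrations. -/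

import Mathlib

open CategoryTheory Limits MonoidalCategory

-- Make `X ⟶ Y` elaborate directly through the category structure.
attribute [-instance] CategoryTheory.catToReflQuiver

universe w u

noncomputable section

namespace HurewiczModel

/-! ### Convenient categories of spaces -/

/-- A property `P` of topological spaces defines a *convenient category of spaces* if the full
subcategory of `TopCat` on the spaces satisfying `P` contains the unit interval (with its standard
topology), is complete and cocomplete, and is cartesian closed.  The cartesian closed structure is
kept as data.  Examples: `k`-spaces, compactly generated weak Hausdorff spaces. -/
class ConvenientSpaces (P : ObjectProperty TopCat.{w}) where
  interval_mem : P TopCat.I.{w}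
  hasLimits : HasLimits P.FullSubcategory
  hasColimits : HasColimits P.FullSubcategory
  cartesian : CartesianMonoidalCategory P.FullSubcategory
  closed : MonoidalClosed P.FullSubcategory

attribute [reducible] ConvenientSpaces.cartesian ConvenientSpaces.closed

attribute [instance] ConvenientSpaces.hasLimits ConvenientSpaces.hasColimits
  ConvenientSpaces.cartesian ConvenientSpaces.closed

section Interval

variable (P : ObjectProperty TopCat.{w}) [ConvenientSpaces P]

/-- The unit interval `I = [0, 1]`, as an object of the convenient category. -/
def interval : P.FullSubcategory := ⟨TopCat.I, ConvenientSpaces.interval_mem⟩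

/-- The inclusion `* ⟶ I` of a point of the unit interval; `* = 𝟙_` is the terminal space. -/
def point (t : unitInterval) : 𝟙_ P.FullSubcategory ⟶ interval P :=
  ObjectProperty.homMk (TopCat.ofHom (ContinuousMap.const _ (ULift.up t)))

end Interval

/-! ### Tensors and cotensors in enriched categories -/

section Tensors

variable {V : Type*} [Category V] [CartesianMonoidalCategory V] [MonoidalClosed V]
  {C : Type*} [Category C] [EnrichedOrdinaryCategory V C]

/-- A tensor `X ⊗ K` of `X : C` with `K : V`: an object together with a universal element
`K ⟶ C(X, X ⊗ K)` for which the induced maps `C(X ⊗ K, Y) ⟶ [K, C(X, Y)]` in `V` (which are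
`V`-natural in `Y`) are isomorphisms. -/
structure Tensor (X : C) (K : V) where
  obj : C
  unit : K ⟶ (X ⟶[V] obj)
  isIso (Y : C) :
    IsIso (MonoidalClosed.curry (unit ▷ (obj ⟶[V] Y) ≫ eComp V X obj Y) :
      (obj ⟶[V] Y) ⟶ (ihom K).obj (X ⟶[V] Y))

/-- A cotensor `X ^ K` of `X : C` with `K : V`: an object together with a universal element
`K ⟶ C(X ^ K, X)` for which the induced maps `C(Y, X ^ K) ⟶ [K, C(Y, X)]` in `V` (which are
`V`-natural in `Y`) are isomorphisms. -/
structure Cotensor (X : C) (K : V) where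
  obj : C
  counit : K ⟶ (obj ⟶[V] X)
  isIso (Y : C) :
    IsIso (MonoidalClosed.curry
      (CartesianMonoidalCategory.lift (CartesianMonoidalCategory.snd K (Y ⟶[V] obj))
        (CartesianMonoidalCategory.fst K (Y ⟶[V] obj) ≫ counit) ≫ eComp V Y obj X) :
      (Y ⟶[V] obj) ⟶ (ihom K).obj (Y ⟶[V] X))

end Tensors

/-! ### Topologically bicomplete categories -/

/-- A *topologically bicomplete category*: a complete and cocomplete category which is enriched,
tensored and cotensored over the convenient category of spaces given by `P`. -/
class TopologicallyBicomplete (P : ObjectProperty TopCat.{w}) [ConvenientSpaces P]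
    (C : Type u) [Category.{w} C] extends EnrichedOrdinaryCategory P.FullSubcategory C where
  hasLimits : HasLimits C
  hasColimits : HasColimits C
  tensor (X : C) (K : P.FullSubcategory) : Tensor X K
  cotensor (X : C) (K : P.FullSubcategory) : Cotensor X K

attribute [instance] TopologicallyBicomplete.hasLimits TopologicallyBicomplete.hasColimits

section Homotopy

variable (P : ObjectProperty TopCat.{w}) [ConvenientSpaces P]
  {C : Type u} [Category.{w} C] [TopologicallyBicomplete P C]

/-- The cylinder `X ⊗ I`. -/
abbrev cyl (X : C) : C := (TopologicallyBicomplete.tensor X (interval P)).obj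

/-- The inclusion `i_t : X ⟶ X ⊗ I` induced by the inclusion of the point `t` into `I`. -/
def cylIncl (t : unitInterval) (X : C) : X ⟶ cyl P X :=
  (eHomEquiv P.FullSubcategory).symm
    (point P t ≫ (TopologicallyBicomplete.tensor X (interval P)).unit)

/-- The path object `Y ^ I`. -/
abbrev pathObj (Y : C) : C := (TopologicallyBicomplete.cotensor Y (interval P)).obj

/-- The evaluation `p_t : Y ^ I ⟶ Y` induced by the inclusion of the point `t` into `I`. -/
def pathEval (t : unitInterval) (Y : C) : pathObj P Y ⟶ Y :=
  (eHomEquiv P.FullSubcategory).symm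
    (point P t ≫ (TopologicallyBicomplete.cotensor Y (interval P)).counit)

/-- Two maps are homotopic if there is a homotopy `h : X ⊗ I ⟶ Y` between them. -/
def Homotopic {X Y : C} (f₀ f₁ : X ⟶ Y) : Prop :=
  ∃ h : cyl P X ⟶ Y, cylIncl P 0 X ≫ h = f₀ ∧ cylIncl P 1 X ≫ h = f₁

variable (C)

/-- The class of homotopy equivalences. -/
def homotopyEquivalences : MorphismProperty C := fun X Y f =>
  ∃ g : Y ⟶ X, Homotopic P (f ≫ g) (𝟙 X) ∧ Homotopic P (g ≫ f) (𝟙 Y)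

/-- The class of `h`-fibrations: the maps with the right lifting property with respect to all
cylinder inclusions `i₀ : Z ⟶ Z ⊗ I`. -/
def hFibrations : MorphismProperty C := fun _ _ p =>
  ∀ Z : C, HasLiftingProperty (cylIncl P 0 Z) p

/-- The class of strong `h`-cofibrations: the maps with the left lifting property with respect
to the `h`-fibrations that are also homotopy equivalences. -/
def strongHCofibrations : MorphismProperty C :=
  (hFibrations P C ⊓ homotopyEquivalences P C).llp

end Homotopy

/-! ### The monomorphism hypothesis -/

/-- An orthogonal factorization system: a weak factorization system in which liftings are unique
(and hence factorizations are unique up to a unique isomorphism). -/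
structure IsOrthogonalFactorizationSystem {C : Type u} [Category.{w} C]
    (E M : MorphismProperty C) : Prop where
  isWeakFactorizationSystem : E.IsWeakFactorizationSystem M
  unique_lift {A B X Y : C} {e : A ⟶ B} {m : X ⟶ Y} (_ : E e) (_ : M m)
    {l l' : B ⟶ X} (_ : e ≫ l = e ≫ l') (_ : l ≫ m = l' ≫ m) : l = l'

/-- `E` is well-copowered: up to isomorphism under `X`, every object `X` has only a (small) set
of `E`-quotients. -/
def IsWellCopowered {C : Type u} [Category.{w} C] (E : MorphismProperty C) : Prop :=
  ∀ X : C, ∃ (ι : Type w) (Q : ι → C) (q : ∀ i, X ⟶ Q i),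
    ∀ (Y : C) (e : X ⟶ Y), E e → ∃ (i : ι) (φ : Q i ≅ Y), q i ≫ φ.hom = e

section MonomorphismHypothesis

variable (P : ObjectProperty TopCat.{w}) [ConvenientSpaces P]
  {C : Type u} [Category.{w} C] [TopologicallyBicomplete P C]

/-- The mapping path space functor `f ↦ N f` on the arrows `f : X ⟶ Y` with fixed target `Y`,
where `N f` is the pullback of `f : X ⟶ Y` and `p₀ : Y ^ I ⟶ Y`. -/
def mappingPath (Y : C) : Over Y ⥤ C :=
  Over.pullback (pathEval P 0 Y) ⋙ Over.forget _

variable (C)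

/-- The *monomorphism hypothesis*: for some well-copowered orthogonal factorization system `(E, M)`
and some (small, infinite) regular cardinal `α`, the mapping path space functor preserves the
colimits of `α`-sequences of arrows `f_β : X_β ⟶ Y` with fixed target `Y`, provided that all the
legs `X_β ⟶ colim X_β` of the colimit cocone belong to `M`. -/
def MonomorphismHypothesis : Prop :=
  ∃ (E M : MorphismProperty C),
    IsOrthogonalFactorizationSystem E M ∧ IsWellCopowered E ∧
    ∃ α : Cardinal.{w}, α.IsRegular ∧
      ∀ (Y : C) (F : α.ord.ToType ⥤ Over Y) (c : Cocone F), IsColimit c →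
        (∀ β, M (c.ι.app β).left) →
        Nonempty (IsColimit ((mappingPath P Y).mapCocone c))

end MonomorphismHypothesis

end HurewiczModel

end

open HomotopicalAlgebra HurewiczModel

/-! By the universal properties of tensor and cotensor, maps out of `X ⊗ I` and maps into `Y ^ I`
are both continuous families of morphisms indexed by `[0,1]`, so classical homotopy arguments can be
carried out with paths in hom spaces.

Homotopy part. Homotopy equivalences are the maps inverted in the homotopy category, which gives
two-out-of-three and retracts. An `h`-fibration that is a homotopy equivalence has a section onto
which it deforms vertically (`exists_section_of_hFibrations`), and therefore the free end of a
mapping cylinder is a strong `h`-cofibration. Maps with the left lifting property against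
`h`-fibrations are deformation retracts. Once every map factors as such a map followed by an
`h`-fibration, the model structure is formal (`exists_modelCategory`).

Factorization part. Over a fixed `Y`, a path lifting function on `f` is an algebra structure for the
pointed endofunctor that glues the cylinder on `N f` to `f` along `N f`. The factorization sends `f`
to a free algebra on it: its structure map is an `h`-fibration, and lifts against another
`h`-fibration exist because its pullback to the free algebra is again an algebra over it. The
endofunctor is only known to preserve the colimits of `α`-sequences with legs in `M`, so the usual
transfinite iteration is modified (`exists_free_algebra`): partial algebras are extended so that
each stage maps to the next through its `E`-image in the colimit. The chain is then interleaved with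
the chain of these images, whose legs do lie in `M`. Well-copoweredness leaves only a set of images
to treat at each stage, and forces `E` to consist of epimorphisms. -/

noncomputable section

namespace HurewiczModel

/-! ### Points of hom spaces -/

section Points

open CartesianMonoidalCategory

variable {P : ObjectProperty TopCat.{w}}

/-- The constant map with value `a`. -/
def constHom {K A : P.FullSubcategory} (a : A.obj) : K ⟶ A :=
  ObjectProperty.homMk (TopCat.ofHom (ContinuousMap.const _ a))

@[simp]
lemma constHom_apply {K A : P.FullSubcategory} (a : A.obj) (k : K.obj) :
    (constHom a : K ⟶ A).hom k = a := rfl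

variable [ConvenientSpaces P]

variable (P) in
lemma nonempty_unit : Nonempty (𝟙_ P.FullSubcategory).obj :=
  ⟨(toUnit (interval P)).hom (ULift.up 0)⟩

/-- The unit is only known to be terminal in the subcategory, so its points are compared through
constant maps from the interval. -/
instance : Subsingleton (𝟙_ P.FullSubcategory).obj where
  allEq a b := by
    have h : (constHom a : interval P ⟶ 𝟙_ P.FullSubcategory) = constHom b := toUnit_unique _ _
    exact congr($(h).hom (ULift.up 0))

variable (P) in
/-- The unique point of the unit space. -/
def unitPoint : (𝟙_ P.FullSubcategory).obj := (nonempty_unit P).some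

lemma unit_hom_ext {A : P.FullSubcategory} {f g : 𝟙_ P.FullSubcategory ⟶ A}
    (h : f.hom (unitPoint P) = g.hom (unitPoint P)) : f = g := by
  ext x
  rw [Subsingleton.elim x (unitPoint P)]
  exact h

/-- The subcategory is full, so every point of `K` is the image of a constant map from the unit. -/
lemma space_hom_ext {K A : P.FullSubcategory} {f g : K ⟶ A}
    (h : ∀ k : 𝟙_ P.FullSubcategory ⟶ K, k ≫ f = k ≫ g) : f = g := by
  ext x
  simpa using congr($(h (constHom x)).hom (unitPoint P))

variable {C : Type u} [Category.{w} C] [TopologicallyBicomplete P C]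

variable (P) in
/-- The point of the hom space `C(X, Y)` corresponding to a morphism `X ⟶ Y`. -/
def homPoint {X Y : C} (f : X ⟶ Y) : (X ⟶[P.FullSubcategory] Y).obj :=
  (eHomEquiv P.FullSubcategory f).hom (unitPoint P)

lemma eHomEquiv_eq_iff {X Y : C} (f : X ⟶ Y)
    (a : 𝟙_ P.FullSubcategory ⟶ (X ⟶[P.FullSubcategory] Y)) :
    eHomEquiv P.FullSubcategory f = a ↔ a.hom (unitPoint P) = homPoint P f :=
  ⟨fun h => by rw [← h]; rfl, fun h => unit_hom_ext h.symm⟩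

lemma eHomEquiv_comp_eq_lift {X Y Z : C} (f : X ⟶ Y) (g : Y ⟶ Z) :
    eHomEquiv P.FullSubcategory (f ≫ g) =
      lift (eHomEquiv P.FullSubcategory f) (eHomEquiv P.FullSubcategory g) ≫ eComp _ X Y Z := by
  rw [eHomEquiv_comp, ← Category.assoc]
  congr 1
  apply CartesianMonoidalCategory.hom_ext
  · simp [toUnit_unique (fst _ _ : 𝟙_ P.FullSubcategory ⊗ 𝟙_ _ ⟶ _) (snd _ _)]
  · simp

/-- A family of morphisms parametrised by the unit interval is a path if it is continuous as a
map to the hom space. -/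
def IsPath (P : ObjectProperty TopCat.{w}) [ConvenientSpaces P] [TopologicallyBicomplete P C]
    {X Y : C} (γ : unitInterval → (X ⟶ Y)) : Prop :=
  Continuous fun t => homPoint P (γ t)

/-- A path of morphisms, as a map of spaces. -/
def IsPath.hom {X Y : C} {γ : unitInterval → (X ⟶ Y)} (hγ : IsPath P γ) :
    interval P ⟶ (X ⟶[P.FullSubcategory] Y) :=
  ObjectProperty.homMk (TopCat.ofHom ⟨fun t => homPoint P (γ t.down),
    hγ.comp continuous_uliftDown⟩)

lemma IsPath.point_hom {X Y : C} {γ : unitInterval → (X ⟶ Y)} (hγ : IsPath P γ)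
    (t : unitInterval) : point P t ≫ hγ.hom = eHomEquiv P.FullSubcategory (γ t) :=
  unit_hom_ext rfl

lemma isPath_iff {X Y : C} (γ : unitInterval → (X ⟶ Y)) :
    IsPath P γ ↔ ∃ a : interval P ⟶ (X ⟶[P.FullSubcategory] Y),
      ∀ t, point P t ≫ a = eHomEquiv P.FullSubcategory (γ t) := by
  refine ⟨fun hγ => ⟨hγ.hom, hγ.point_hom⟩, fun ⟨a, ha⟩ => ?_⟩
  have : (fun t => homPoint P (γ t)) = fun t => a.hom (ULift.up t) := by
    funext t
    exact ((eHomEquiv_eq_iff _ _).1 (ha t).symm).symm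
  rw [IsPath, this]
  exact (TopCat.Hom.hom a.hom).continuous.comp continuous_uliftUp

lemma isPath_const {X Y : C} (f : X ⟶ Y) : IsPath P fun _ => f := continuous_const

/-- The categorical product of hom spaces need not carry the product topology, so the two paths are
paired inside the convenient category before the enriched composition is applied. -/
lemma IsPath.comp {X Y Z : C} {γ : unitInterval → (X ⟶ Y)} {δ : unitInterval → (Y ⟶ Z)}
    (hγ : IsPath P γ) (hδ : IsPath P δ) : IsPath P fun t => γ t ≫ δ t :=
  (isPath_iff _).2 ⟨lift hγ.hom hδ.hom ≫ eComp _ X Y Z, fun t => by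
    rw [eHomEquiv_comp_eq_lift, comp_lift_assoc, hγ.point_hom, hδ.point_hom]⟩

lemma IsPath.precomp {X Y Z : C} {γ : unitInterval → (X ⟶ Y)} (hγ : IsPath P γ) (f : Z ⟶ X) :
    IsPath P fun t => f ≫ γ t :=
  (isPath_const f).comp hγ

lemma IsPath.postcomp {X Y Z : C} {γ : unitInterval → (X ⟶ Y)} (hγ : IsPath P γ) (f : Y ⟶ Z) :
    IsPath P fun t => γ t ≫ f :=
  hγ.comp (isPath_const f)

lemma IsPath.reparam {X Y : C} {γ : unitInterval → (X ⟶ Y)} (hγ : IsPath P γ)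
    {φ : unitInterval → unitInterval} (hφ : Continuous φ) : IsPath P fun t => γ (φ t) :=
  Continuous.comp hγ hφ

/-! ### Maps out of the cylinder and into the path object -/

lemma isPath_cylIncl (X : C) : IsPath P fun t => cylIncl P t X :=
  (isPath_iff _).2 ⟨(TopologicallyBicomplete.tensor X (interval P)).unit, fun t => by
    simp [cylIncl]⟩

lemma isPath_pathEval (X : C) : IsPath P fun t => pathEval P t X :=
  (isPath_iff _).2 ⟨(TopologicallyBicomplete.cotensor X (interval P)).counit, fun t => by
    simp [pathEval]⟩

lemma point_surjective (k : 𝟙_ P.FullSubcategory ⟶ interval P) : ∃ t, k = point P t :=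
  ⟨(k.hom (unitPoint P)).down, unit_hom_ext rfl⟩

/-- Under the universal property a map out of the cylinder becomes a map of spaces out of `I ⊗ 𝟙_`,
and such maps are determined by their values at points. -/
lemma Tensor.hom_ext {X Y : C} {f g : cyl P X ⟶ Y}
    (h : ∀ t, cylIncl P t X ≫ f = cylIncl P t X ≫ g) : f = g := by
  have := (TopologicallyBicomplete.tensor X (interval P)).isIso Y
  apply (eHomEquiv P.FullSubcategory).injective
  rw [← cancel_mono (MonoidalClosed.curry
    ((TopologicallyBicomplete.tensor X (interval P)).unit ▷ _ ≫ eComp _ X _ Y))]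
  apply MonoidalClosed.uncurry_injective
  rw [MonoidalClosed.uncurry_natural_left, MonoidalClosed.uncurry_natural_left,
    MonoidalClosed.uncurry_curry]
  refine space_hom_ext fun k => ?_
  obtain ⟨t, ht⟩ := point_surjective (k ≫ fst _ _)
  have key (h : cyl P X ⟶ Y) : k ≫ interval P ◁ eHomEquiv P.FullSubcategory h ≫
      (TopologicallyBicomplete.tensor X (interval P)).unit ▷ _ ≫ eComp _ X _ Y =
      eHomEquiv P.FullSubcategory (cylIncl P t X ≫ h) := by
    rw [eHomEquiv_comp_eq_lift, cylIncl, Equiv.apply_symm_apply, ← ht, ← Category.assoc,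
      ← Category.assoc]
    congr 1
    apply CartesianMonoidalCategory.hom_ext
    · simp
    · have : k ≫ snd _ _ = 𝟙 _ := toUnit_unique _ _
      simp [reassoc_of% this]
  exact (key f).trans ((congrArg _ (h t)).trans (key g).symm)

/-- Currying a map on the categorical square of the interval gives a path in `[I, C(X, Y)]`, which
is `C(X ⊗ I, Y)`. Continuity for the product topology suffices, because both projections of the
categorical square are continuous. -/
lemma exists_path_cyl {X Y : C} (F : unitInterval → unitInterval → (X ⟶ Y))
    (hF : Continuous fun q : unitInterval × unitInterval => homPoint P (F q.1 q.2)) :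
    ∃ γ : unitInterval → (cyl P X ⟶ Y), IsPath P γ ∧ ∀ s t, cylIncl P t X ≫ γ s = F s t := by
  let a : interval P ⊗ interval P ⟶ (X ⟶[P.FullSubcategory] Y) :=
    ObjectProperty.homMk (TopCat.ofHom ⟨fun z => homPoint P
      (F ((snd (interval P) (interval P)).hom z).down ((fst (interval P) (interval P)).hom z).down),
      hF.comp ((continuous_uliftDown.comp
        (TopCat.Hom.hom (snd (interval P) (interval P)).hom).continuous).prodMk
        (continuous_uliftDown.comp (TopCat.Hom.hom (fst (interval P) (interval P)).hom).continuous))⟩)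
  have ha (s t) : lift (point P t) (point P s) ≫ a = eHomEquiv P.FullSubcategory (F s t) := by
    apply unit_hom_ext
    have h₁ := congr($(lift_fst (point P t) (point P s)).hom (unitPoint P))
    have h₂ := congr($(lift_snd (point P t) (point P s)).hom (unitPoint P))
    simp only [ObjectProperty.FullSubcategory.comp_hom, TopCat.comp_app] at h₁ h₂
    change homPoint P (F (ULift.down _) (ULift.down _)) = _
    erw [h₁, h₂]
    rfl
  let T := TopologicallyBicomplete.tensor X (interval P)
  have := T.isIso Y
  let c := MonoidalClosed.curry (T.unit ▷ (T.obj ⟶[P.FullSubcategory] Y) ≫ eComp _ X T.obj Y)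
  let b : interval P ⟶ (cyl P X ⟶[P.FullSubcategory] Y) := MonoidalClosed.curry a ≫ inv c
  have hb : interval P ◁ b ≫ T.unit ▷ _ ≫ eComp _ X _ Y = a := by
    apply MonoidalClosed.curry_injective
    rw [MonoidalClosed.curry_natural_left]
    simp only [b, Category.assoc]
    exact (congrArg _ (IsIso.inv_hom_id c)).trans (Category.comp_id _)
  refine ⟨fun s => (eHomEquiv P.FullSubcategory).symm (point P s ≫ b),
    (isPath_iff _).2 ⟨b, by simp⟩, fun s t => (eHomEquiv P.FullSubcategory).injective ?_⟩
  rw [eHomEquiv_comp_eq_lift, Equiv.apply_symm_apply, cylIncl, Equiv.apply_symm_apply, ← ha, ← hb]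
  simp only [← Category.assoc]
  congr 1
  apply CartesianMonoidalCategory.hom_ext <;> simp [T]

lemma exists_cyl_desc {X Y : C} {γ : unitInterval → (X ⟶ Y)} (hγ : IsPath P γ) :
    ∃ h : cyl P X ⟶ Y, ∀ t, cylIncl P t X ≫ h = γ t := by
  obtain ⟨δ, -, h⟩ := exists_path_cyl (fun _ t => γ t) (Continuous.comp hγ continuous_snd)
  exact ⟨δ 0, h 0⟩

lemma Cotensor.hom_ext {X Y : C} {f g : X ⟶ pathObj P Y}
    (h : ∀ t, f ≫ pathEval P t Y = g ≫ pathEval P t Y) : f = g := by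
  let T := TopologicallyBicomplete.cotensor Y (interval P)
  have := T.isIso X
  apply (eHomEquiv P.FullSubcategory).injective
  rw [← cancel_mono (MonoidalClosed.curry (lift (snd (interval P) (X ⟶[P.FullSubcategory] T.obj))
        (fst (interval P) (X ⟶[P.FullSubcategory] T.obj) ≫ T.counit) ≫ eComp _ X T.obj Y))]
  apply MonoidalClosed.uncurry_injective
  rw [MonoidalClosed.uncurry_natural_left, MonoidalClosed.uncurry_natural_left,
    MonoidalClosed.uncurry_curry]
  refine space_hom_ext fun k => ?_
  obtain ⟨t, ht⟩ := point_surjective (k ≫ fst _ _)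
  have key (h : X ⟶ pathObj P Y) : k ≫ interval P ◁ eHomEquiv P.FullSubcategory h ≫
      lift (snd (interval P) (X ⟶[P.FullSubcategory] T.obj))
        (fst (interval P) (X ⟶[P.FullSubcategory] T.obj) ≫ T.counit) ≫ eComp _ X T.obj Y =
      eHomEquiv P.FullSubcategory (h ≫ pathEval P t Y) := by
    rw [eHomEquiv_comp_eq_lift, pathEval, Equiv.apply_symm_apply, ← ht, ← Category.assoc,
      ← Category.assoc]
    congr 1
    apply CartesianMonoidalCategory.hom_ext
    · have : k ≫ snd _ _ = 𝟙 _ := toUnit_unique _ _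
      simp only [Category.assoc, lift_fst, whiskerLeft_snd, reassoc_of% this]
      exact (lift_fst _ _).symm
    · simp [T]
  exact (key f).trans ((congrArg _ (h t)).trans (key g).symm)

lemma exists_pathObj_lift {X Y : C} {γ : unitInterval → (X ⟶ Y)} (hγ : IsPath P γ) :
    ∃ h : X ⟶ pathObj P Y, ∀ t, h ≫ pathEval P t Y = γ t := by
  let T := TopologicallyBicomplete.cotensor Y (interval P)
  have := T.isIso X
  let c' := lift (snd (interval P) (X ⟶[P.FullSubcategory] T.obj))
    (fst (interval P) (X ⟶[P.FullSubcategory] T.obj) ≫ T.counit) ≫ eComp _ X T.obj Y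
  let c := MonoidalClosed.curry c'
  let b : 𝟙_ P.FullSubcategory ⟶ (X ⟶[P.FullSubcategory] T.obj) :=
    MonoidalClosed.curry (fst _ _ ≫ hγ.hom) ≫ inv c
  have hb : interval P ◁ b ≫ c' = fst _ _ ≫ hγ.hom := by
    apply MonoidalClosed.curry_injective
    rw [MonoidalClosed.curry_natural_left]
    simp only [b, Category.assoc]
    exact (congrArg _ (IsIso.inv_hom_id c)).trans (Category.comp_id _)
  refine ⟨(eHomEquiv P.FullSubcategory).symm b,
    fun t => (eHomEquiv P.FullSubcategory).injective ?_⟩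
  rw [eHomEquiv_comp_eq_lift, Equiv.apply_symm_apply, pathEval, Equiv.apply_symm_apply,
    ← hγ.point_hom]
  have := congr(lift (point P t) (𝟙 _) ≫ $hb)
  rw [lift_fst_assoc] at this
  rw [← this]
  simp only [c', ← Category.assoc]
  congr 1
  apply CartesianMonoidalCategory.hom_ext <;> simp [T]

end Points


/-! ### Calculus of paths -/

section Paths

open unitInterval

variable {P : ObjectProperty TopCat.{w}} [ConvenientSpaces P]
  {C : Type u} [Category.{w} C] [TopologicallyBicomplete P C]

lemma IsPath.symm {X Y : C} {γ : I → (X ⟶ Y)} (hγ : IsPath P γ) : IsPath P fun t => γ (σ t) :=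
  hγ.reparam continuous_symm

/-- The affine reparametrisation `t ↦ (s + t) / 2` of the unit interval. -/
def midpoint (s t : I) : I :=
  ⟨((s : ℝ) + t) / 2, by
    have := s.2.1; have := s.2.2; have := t.2.1; have := t.2.2
    constructor <;> linarith⟩

lemma continuous_midpoint : Continuous fun q : I × I => midpoint q.1 q.2 := by
  unfold midpoint
  fun_prop

@[simp]
lemma midpoint_self (t : I) : midpoint t t = t := by
  ext
  simp [midpoint]

/-- The parameter `τ + s (1 - τ)`. -/
def convexSum (τ s : I) : I := σ (σ τ * σ s)

lemma continuous_convexSum : Continuous fun q : I × I => convexSum q.1 q.2 := by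
  unfold convexSum
  fun_prop

@[simp]
lemma convexSum_zero_right (τ : I) : convexSum τ 0 = τ := by simp [convexSum]

@[simp]
lemma convexSum_zero_left (s : I) : convexSum 0 s = s := by simp [convexSum]

@[simp]
lemma convexSum_one_right (τ : I) : convexSum τ 1 = 1 := by simp [convexSum]

@[simp]
lemma convexSum_one_left (s : I) : convexSum 1 s = 1 := by simp [convexSum]

/-- Concatenation of paths. -/
lemma IsPath.exists_trans {X Y : C} {γ δ : I → (X ⟶ Y)} (hγ : IsPath P γ) (hδ : IsPath P δ)
    (h : γ 1 = δ 0) :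
    ∃ c : I → (X ⟶ Y), IsPath P c ∧ (∀ t, c (midpoint 0 t) = γ t) ∧
      (∀ t, c (midpoint 1 t) = δ t) ∧ ∀ s, (∃ t, c s = γ t) ∨ ∃ t, c s = δ t := by
  -- `Set.projIcc` clamps the parameter, so both branches are continuous on all of `I`; they agree
  -- at `1/2` by `h`.
  let c : I → (X ⟶ Y) := fun s =>
    if (s : ℝ) ≤ 1 / 2 then γ (Set.projIcc 0 1 zero_le_one (2 * s))
    else δ (Set.projIcc 0 1 zero_le_one (2 * s - 1))
  have hr : Continuous fun s : I => homPoint P (γ (Set.projIcc 0 1 zero_le_one (2 * (s : ℝ)))) :=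
    hγ.reparam (φ := fun s : I => Set.projIcc 0 1 zero_le_one (2 * (s : ℝ))) (by fun_prop)
  have hs : Continuous fun s : I =>
      homPoint P (δ (Set.projIcc 0 1 zero_le_one (2 * (s : ℝ) - 1))) :=
    hδ.reparam (φ := fun s : I => Set.projIcc 0 1 zero_le_one (2 * (s : ℝ) - 1)) (by fun_prop)
  refine ⟨c, ?_, fun t => ?_, fun t => ?_, fun s => ?_⟩
  · have : (fun s => homPoint P (c s)) = fun s : I =>
        if (s : ℝ) ≤ 1 / 2 then homPoint P (γ (Set.projIcc 0 1 zero_le_one (2 * s)))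
        else homPoint P (δ (Set.projIcc 0 1 zero_le_one (2 * s - 1))) := by
      funext s
      simp only [c]
      split_ifs <;> rfl
    rw [IsPath, this]
    refine hr.if_le hs (by fun_prop) (by fun_prop) fun s hs => ?_
    rw [hs]
    norm_num
    exact congrArg _ h
  · have h₁ : ((midpoint 0 t : I) : ℝ) = t / 2 := by simp [midpoint]
    have : (t : ℝ) / 2 ≤ 1 / 2 := by linarith [t.2.2]
    simp only [c, h₁, this, if_true]
    congr 1
    rw [mul_div_cancel₀ _ two_ne_zero, Set.projIcc_val]
  · have h₁ : ((midpoint 1 t : I) : ℝ) = (1 + t) / 2 := by simp [midpoint]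
    by_cases ht : t = 0
    · subst ht
      have : ((midpoint 1 0 : I) : ℝ) = 1 / 2 := by simp [midpoint]
      simp [c, this, h]
    · have : ¬ ((1 + (t : ℝ)) / 2 ≤ 1 / 2) := by
        have := unitInterval.pos_iff_ne_zero.2 ht
        have : (0 : ℝ) < t := this
        linarith
      simp only [c, h₁, this, if_false]
      congr 1
      rw [mul_div_cancel₀ _ two_ne_zero, add_sub_cancel_left, Set.projIcc_val]
  · by_cases h : (s : ℝ) ≤ 1 / 2
    · exact Or.inl ⟨_, if_pos h⟩
    · exact Or.inr ⟨_, if_neg h⟩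

lemma homotopic_iff {X Y : C} (f g : X ⟶ Y) :
    Homotopic P f g ↔ ∃ γ : I → (X ⟶ Y), IsPath P γ ∧ γ 0 = f ∧ γ 1 = g := by
  constructor
  · rintro ⟨h, h₀, h₁⟩
    exact ⟨_, (isPath_cylIncl X).postcomp h, h₀, h₁⟩
  · rintro ⟨γ, hγ, h₀, h₁⟩
    obtain ⟨h, hh⟩ := exists_cyl_desc hγ
    exact ⟨h, (hh 0).trans h₀, (hh 1).trans h₁⟩

/-- Two maps `Z ⟶ E` are vertically homotopic over `p : E ⟶ B` if they are connected by a path of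
maps with the same composition with `p`. -/
def VertHomotopic (P : ObjectProperty TopCat.{w}) [ConvenientSpaces P] [TopologicallyBicomplete P C]
    {Z E B : C} (p : E ⟶ B) (f g : Z ⟶ E) : Prop :=
  ∃ γ : I → (Z ⟶ E), IsPath P γ ∧ γ 0 = f ∧ γ 1 = g ∧ ∀ t, γ t ≫ p = f ≫ p

lemma VertHomotopic.comp_eq {Z E B : C} {p : E ⟶ B} {f g : Z ⟶ E} (h : VertHomotopic P p f g) :
    f ≫ p = g ≫ p := by
  obtain ⟨γ, -, -, h₁, hp⟩ := h
  rw [← h₁, hp]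

lemma VertHomotopic.symm {Z E B : C} {p : E ⟶ B} {f g : Z ⟶ E} (h : VertHomotopic P p f g) :
    VertHomotopic P p g f := by
  have e := h.comp_eq
  obtain ⟨γ, hγ, h₀, h₁, hp⟩ := h
  exact ⟨_, hγ.symm, by simpa using h₁, by simpa using h₀, fun t => (hp _).trans e⟩

lemma VertHomotopic.trans {Z E B : C} {p : E ⟶ B} {f g h : Z ⟶ E}
    (h₁ : VertHomotopic P p f g) (h₂ : VertHomotopic P p g h) : VertHomotopic P p f h := by
  have e := h₁.comp_eq
  obtain ⟨γ, hγ, γ₀, γ₁, γp⟩ := h₁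
  obtain ⟨δ, hδ, δ₀, δ₁, δp⟩ := h₂
  obtain ⟨c, hc, c₀, c₁, h⟩ := hγ.exists_trans hδ (γ₁.trans δ₀.symm)
  refine ⟨c, hc, ?_, ?_, fun t => ?_⟩
  · rw [← γ₀, ← c₀, midpoint_self]
  · rw [← δ₁, ← c₁, midpoint_self]
  · obtain ⟨s, hs⟩ | ⟨s, hs⟩ := h t <;> rw [hs]
    · exact γp s
    · exact (δp s).trans e.symm

end Paths

/-! ### Homotopy equivalences -/

section HomotopyEquivalences

variable (P : ObjectProperty TopCat.{w}) [ConvenientSpaces P]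
  (C : Type u) [Category.{w} C] [TopologicallyBicomplete P C]

/-- The homotopy relation on morphisms. -/
def homotopyRel : HomRel C := fun _ _ f g => Homotopic P f g

instance : Congruence (homotopyRel P C) where
  comp_left f _ _ h := by
    obtain ⟨γ, hγ, h₀, h₁⟩ := (homotopic_iff _ _).1 h
    exact (homotopic_iff _ _).2 ⟨_, hγ.precomp f, by rw [h₀], by rw [h₁]⟩
  comp_right g h := by
    obtain ⟨γ, hγ, h₀, h₁⟩ := (homotopic_iff _ _).1 h
    exact (homotopic_iff _ _).2 ⟨_, hγ.postcomp g, by rw [h₀], by rw [h₁]⟩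
  equivalence := {
    refl f := (homotopic_iff _ _).2 ⟨_, isPath_const f, rfl, rfl⟩
    symm h := by
      obtain ⟨γ, hγ, h₀, h₁⟩ := (homotopic_iff _ _).1 h
      exact (homotopic_iff _ _).2 ⟨_, hγ.symm, by simpa using h₁, by simpa using h₀⟩
    trans h h' := by
      obtain ⟨γ, hγ, γ₀, γ₁⟩ := (homotopic_iff _ _).1 h
      obtain ⟨δ, hδ, δ₀, δ₁⟩ := (homotopic_iff _ _).1 h'
      obtain ⟨c, hc, c₀, c₁, -⟩ := hγ.exists_trans hδ (γ₁.trans δ₀.symm)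
      refine (homotopic_iff _ _).2 ⟨c, hc, ?_, ?_⟩
      · rw [← γ₀, ← c₀, midpoint_self]
      · rw [← δ₁, ← c₁, midpoint_self] }

/-- Two-out-of-three and stability under retracts are inherited from isomorphisms in the homotopy
category. -/
lemma homotopyEquivalences_eq : homotopyEquivalences P C =
    (MorphismProperty.isomorphisms _).inverseImage (Quotient.functor (homotopyRel P C)) := by
  ext X Y f
  constructor
  · rintro ⟨g, h₁, h₂⟩
    refine ⟨(Quotient.functor _).map g, ?_, ?_⟩
    · rw [← Functor.map_comp]
      exact (CategoryTheory.Quotient.sound (homotopyRel P C) h₁).trans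
        ((Quotient.functor _).map_id X)
    · rw [← Functor.map_comp]
      exact (CategoryTheory.Quotient.sound (homotopyRel P C) h₂).trans
        ((Quotient.functor _).map_id Y)
  · rintro ⟨g, h₁, h₂⟩
    obtain ⟨g, rfl⟩ := (Quotient.functor (homotopyRel P C)).map_surjective g
    rw [← Functor.map_comp] at h₁ h₂
    exact ⟨g, (Quotient.functor_map_eq_iff (homotopyRel P C) _ _).1
        (h₁.trans ((Quotient.functor _).map_id X).symm),
      (Quotient.functor_map_eq_iff (homotopyRel P C) _ _).1
        (h₂.trans ((Quotient.functor _).map_id Y).symm)⟩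

instance : (homotopyEquivalences P C).HasTwoOutOfThreeProperty := by
  rw [homotopyEquivalences_eq]
  infer_instance

instance : (homotopyEquivalences P C).IsStableUnderRetracts := by
  rw [homotopyEquivalences_eq]
  infer_instance

end HomotopyEquivalences

/-! ### Fibrations -/

section Fibrations

open unitInterval

variable {P : ObjectProperty TopCat.{w}} [ConvenientSpaces P]
  {C : Type u} [Category.{w} C] [TopologicallyBicomplete P C]

lemma hFibrations_iff {E B : C} (p : E ⟶ B) : hFibrations P C p ↔
    ∀ ⦃Z : C⦄ (e : Z ⟶ E) (γ : I → (Z ⟶ B)), IsPath P γ → γ 0 = e ≫ p →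
      ∃ δ : I → (Z ⟶ E), IsPath P δ ∧ δ 0 = e ∧ ∀ t, δ t ≫ p = γ t := by
  constructor
  · intro hp Z e γ hγ h₀
    obtain ⟨h, hh⟩ := exists_cyl_desc hγ
    have := hp Z
    have sq : CommSq e (cylIncl P 0 Z) p h := ⟨by rw [hh, h₀]⟩
    exact ⟨_, (isPath_cylIncl Z).postcomp sq.lift, sq.fac_left, fun t => by
      rw [Category.assoc, sq.fac_right, hh]⟩
  · intro hp Z
    refine ⟨fun {e h} sq => ?_⟩
    obtain ⟨δ, hδ, h₀, h₁⟩ := hp e _ ((isPath_cylIncl (P := P) Z).postcomp h) sq.w.symm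
    obtain ⟨l, hl⟩ := exists_cyl_desc hδ
    refine ⟨⟨l, by rw [hl, h₀], Tensor.hom_ext fun t => ?_⟩⟩
    rw [← Category.assoc, hl, h₁]

lemma hFibrations_eq_rlp : hFibrations P C =
    (MorphismProperty.ofHoms fun Z : C => cylIncl P 0 Z).rlp := by
  ext E B p
  constructor
  · rintro hp _ _ _ ⟨Z⟩
    exact hp _
  · exact fun hp Z => hp _ ⟨Z⟩

instance : (hFibrations P C).IsStableUnderRetracts := by
  rw [hFibrations_eq_rlp]
  infer_instance

instance : (hFibrations P C).IsStableUnderBaseChange := by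
  rw [hFibrations_eq_rlp]
  infer_instance

lemma rlp_llp_hFibrations : (hFibrations P C).llp.rlp = hFibrations P C := by
  rw [hFibrations_eq_rlp, MorphismProperty.rlp_llp_rlp]

lemma llp_hFibrations_cylIncl (Z : C) : (hFibrations P C).llp (cylIncl P 0 Z) :=
  fun _ _ _ hp => hp Z

variable (P) in
/-- The mapping path object `N p`. -/
abbrev mapPath {E B : C} (p : E ⟶ B) : C := pullback p (pathEval P 0 B)

lemma mapPath_hom_ext {E B Z : C} {p : E ⟶ B} {f g : Z ⟶ mapPath P p}
    (h₁ : f ≫ pullback.fst _ _ = g ≫ pullback.fst _ _)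
    (h₂ : ∀ t, f ≫ pullback.snd _ _ ≫ pathEval P t B = g ≫ pullback.snd _ _ ≫ pathEval P t B) :
    f = g :=
  pullback.hom_ext h₁ (Cotensor.hom_ext fun t => by simpa using h₂ t)

lemma exists_mapPath_lift {E B Z : C} (p : E ⟶ B) (e : Z ⟶ E) {γ : I → (Z ⟶ B)}
    (hγ : IsPath P γ) (h₀ : γ 0 = e ≫ p) :
    ∃ n : Z ⟶ mapPath P p, n ≫ pullback.fst _ _ = e ∧
      ∀ t, n ≫ pullback.snd _ _ ≫ pathEval P t B = γ t := by
  obtain ⟨h, hh⟩ := exists_pathObj_lift hγ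
  exact ⟨pullback.lift e h (by rw [hh, h₀]), pullback.lift_fst _ _ _, fun t => by
    rw [pullback.lift_snd_assoc, hh]⟩

/-- The path of maps `N p ⟶ B` tautologically given by the second projection. -/
lemma isPath_mapPath {E B : C} (p : E ⟶ B) :
    IsPath P fun t => (pullback.snd _ _ : mapPath P p ⟶ _) ≫ pathEval P t B :=
  (isPath_pathEval B).precomp _

/-- A path lifting function for `p`: a universal solution of the homotopy lifting problem. -/
structure IsPathLifting {E B : C} (p : E ⟶ B) (l : I → (mapPath P p ⟶ E)) : Prop where
  isPath : IsPath P l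
  zero : l 0 = pullback.fst _ _
  comp (t : I) : l t ≫ p = pullback.snd _ _ ≫ pathEval P t B

/-- `N p` represents homotopy lifting problems for `p`, so it is enough to solve the tautological
one. -/
lemma hFibrations_iff_exists_isPathLifting {E B : C} (p : E ⟶ B) :
    hFibrations P C p ↔ ∃ l : I → (mapPath P p ⟶ E), IsPathLifting p l := by
  rw [hFibrations_iff]
  constructor
  · intro hp
    obtain ⟨l, h₁, h₂, h₃⟩ := hp (pullback.fst _ _) _ (isPath_mapPath p) pullback.condition.symm
    exact ⟨l, h₁, h₂, h₃⟩
  · rintro ⟨l, hl⟩ Z e γ hγ h₀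
    obtain ⟨n, hn₁, hn₂⟩ := exists_mapPath_lift p e hγ h₀
    exact ⟨_, hl.isPath.precomp n, by rw [hl.zero, hn₁], fun t => by
      rw [Category.assoc, hl.comp, hn₂]⟩

/-- If `G` is a path of maps `Z ⟶ E`, then `G 1` is vertically homotopic to the end point of the
chosen lifting of `p ∘ G` starting at `G 0`. -/
lemma IsPathLifting.vertHomotopic {E B Z : C} {p : E ⟶ B} {l : I → (mapPath P p ⟶ E)}
    (hl : IsPathLifting p l) {G : I → (Z ⟶ E)} (hG : IsPath P G) {n : Z ⟶ mapPath P p}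
    (h₀ : n ≫ pullback.fst _ _ = G 0)
    (hn : ∀ t, n ≫ pullback.snd _ _ ≫ pathEval P t B = G t ≫ p) :
    VertHomotopic P p (G 1) (n ≫ l 1) := by
  obtain ⟨g, hg⟩ := exists_cyl_desc hG
  -- At cylinder time `t` this is the remaining part of `p ∘ G`, from time `t` to time `1`; `m`
  -- below pairs it with its initial point `G t`.
  obtain ⟨δ, hδ, hδ'⟩ := exists_path_cyl (P := P) (fun s t => G (convexSum t s) ≫ p)
    (Continuous.comp (hG.postcomp p) (continuous_convexSum.comp continuous_swap))
  have hδ₀ : δ 0 = g ≫ p := Tensor.hom_ext fun t => by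
    rw [hδ', convexSum_zero_right, ← Category.assoc, hg]
  obtain ⟨m, hm₁, hm₂⟩ := exists_mapPath_lift p g hδ hδ₀
  have hmn : cylIncl P 0 Z ≫ m = n := mapPath_hom_ext (by rw [Category.assoc, hm₁, hg, h₀])
    fun t => by rw [Category.assoc, hm₂, hδ', convexSum_zero_left, hn]
  have hvert (s t : I) : cylIncl P t Z ≫ m ≫ l s ≫ p = G (convexSum t s) ≫ p := by
    rw [hl.comp, hm₂, hδ']
  -- At `t = 1` the remaining path is constant, so its whole lifting is vertical.
  have h₁ : VertHomotopic P p (G 1) (cylIncl P 1 Z ≫ m ≫ l 1) :=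
    ⟨_, (hl.isPath.precomp m).precomp (cylIncl P 1 Z), by rw [hl.zero, hm₁, hg], rfl, fun t => by
      simpa using hvert t 1⟩
  -- All remaining paths end at `p ∘ G 1`, so moving `t` moves the end point of the lifting
  -- vertically.
  have h₂ : VertHomotopic P p (cylIncl P 0 Z ≫ m ≫ l 1) (cylIncl P 1 Z ≫ m ≫ l 1) :=
    ⟨_, (isPath_cylIncl Z).postcomp (m ≫ l 1), rfl, rfl, fun t => by
      simpa using (hvert 1 t).trans ((by simp : _ = _).trans (hvert 1 0).symm)⟩
  rw [← hmn, Category.assoc]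
  exact h₁.trans h₂.symm

/-- An `h`-fibration which is a homotopy equivalence is shrinkable. -/
lemma exists_section_of_hFibrations {E B : C} {p : E ⟶ B} (hp : hFibrations P C p)
    (hp' : homotopyEquivalences P C p) :
    ∃ s : B ⟶ E, s ≫ p = 𝟙 B ∧ VertHomotopic P p (p ≫ s) (𝟙 E) := by
  obtain ⟨g, h₁, h₂⟩ := hp'
  obtain ⟨γ, hγ, γ₀, γ₁⟩ := (homotopic_iff _ _).1 h₂
  -- Lifting the homotopy from `g ≫ p` to the identity, starting at `g`, deforms the homotopy
  -- inverse `g` into the strict section `δ 1`.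
  obtain ⟨δ, hδ, δ₀, δp⟩ := (hFibrations_iff p).1 hp g γ hγ γ₀
  have hs : δ 1 ≫ p = 𝟙 B := (δp 1).trans γ₁
  have hgs : Homotopic P (p ≫ g) (p ≫ δ 1) :=
    (homotopic_iff _ _).2 ⟨_, hδ.precomp p, by rw [δ₀], rfl⟩
  have hsp : Homotopic P (p ≫ δ 1) (𝟙 E) :=
    have hr := Congruence.equivalence (r := homotopyRel P C) (X := E) (Y := E)
    hr.trans (hr.symm hgs) h₁
  obtain ⟨H, hH, H₀, H₁⟩ := (homotopic_iff _ _).1 hsp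
  obtain ⟨l, hl⟩ := (hFibrations_iff_exists_isPathLifting p).1 hp
  obtain ⟨n, hn₁, hn₂⟩ := exists_mapPath_lift p (H 0) (hH.postcomp p) rfl
  have v₁ := hl.vertHomotopic hH hn₁ hn₂
  -- The paths `H` and `H ≫ p ≫ δ 1` have the same start and the same image in `B`, hence the same
  -- chosen lifting. Both end points are therefore vertically homotopic to `n ≫ l 1`.
  have v₂ := hl.vertHomotopic (hH.postcomp (p ≫ δ 1)) (n := n)
    (by rw [hn₁, H₀, Category.assoc, reassoc_of% hs])
    (fun t => by rw [hn₂, Category.assoc, Category.assoc, hs, Category.comp_id])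
  refine ⟨δ 1, hs, ?_⟩
  rw [H₁] at v₁ v₂
  rw [Category.id_comp] at v₂
  exact v₂.trans v₁.symm

/-- The end point projection of the mapping path object. -/
lemma hFibrations_mapPath {X Y : C} (f : X ⟶ Y) :
    hFibrations P C ((pullback.snd _ _ : mapPath P f ⟶ _) ≫ pathEval P 1 Y) := by
  refine (hFibrations_iff _).2 fun Z e γ hγ h₀ => ?_
  obtain ⟨c, hc, c₀, c₁, -⟩ := ((isPath_mapPath f).precomp e).exists_trans hγ h₀.symm
  obtain ⟨h, hh⟩ := exists_cyl_desc (isPath_const (P := P) (e ≫ pullback.fst _ _))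
  -- At time `s` the new path follows the concatenation `c` up to `(1 + s) / 2`: for `s = 0` it is
  -- the original path, and its end point is always `γ s`.
  obtain ⟨δ, hδ, hδ'⟩ := exists_path_cyl (P := P) (fun t s => c (t * midpoint 1 s))
    (Continuous.comp hc (continuous_fst.mul
      (continuous_midpoint.comp (continuous_const.prodMk continuous_snd))))
  have hδ₀ : δ 0 = h ≫ f := Tensor.hom_ext fun s => by
    have := c₀ 0
    rw [midpoint_self] at this
    rw [hδ', zero_mul, reassoc_of% (hh s), this, pullback.condition]
  obtain ⟨n, hn₁, hn₂⟩ := exists_mapPath_lift f h hδ hδ₀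
  refine ⟨_, (isPath_cylIncl Z).postcomp n, mapPath_hom_ext ?_ fun t => ?_, fun s => ?_⟩
  · rw [Category.assoc, hn₁, hh]
  · rw [Category.assoc, hn₂, hδ', ← c₀]
    congr 1
    ext
    simp [midpoint, div_eq_mul_inv]
  · rw [Category.assoc, hn₂, hδ', one_mul, c₁]

/-- Lift the inclusion of constant paths `A ⟶ N j` along `j` against the end point fibration. The
lift sends `X` to paths that start in the image of a retraction onto `A` and end at the identity, so
it is the required homotopy. -/
lemma llp_hFibrations_le_homotopyEquivalences {A X : C} {j : A ⟶ X}
    (hj : (hFibrations P C).llp j) : homotopyEquivalences P C j := by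
  obtain ⟨i, hi₁, hi₂⟩ := exists_mapPath_lift j (𝟙 A) (isPath_const (P := P) j) (by simp)
  have := hj _ (hFibrations_mapPath (P := P) j)
  have sq : CommSq i j (pullback.snd _ _ ≫ pathEval P 1 X) (𝟙 X) := ⟨by
    rw [hi₂, Category.comp_id]⟩
  refine ⟨sq.lift ≫ pullback.fst _ _, ?_, ?_⟩
  · rw [sq.fac_left_assoc, hi₁]
    exact (inferInstance : Congruence (homotopyRel P C)).equivalence.refl _
  · refine (homotopic_iff _ _).2 ⟨_, (isPath_mapPath j).precomp sq.lift, ?_, sq.fac_right⟩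
    rw [Category.assoc, ← pullback.condition]

end Fibrations

/-! ### The mapping cylinder -/

section MappingCylinder

open unitInterval

variable (P : ObjectProperty TopCat.{w}) [ConvenientSpaces P]
  {C : Type u} [Category.{w} C] [TopologicallyBicomplete P C]

/-- The mapping cylinder of `f : X ⟶ Y`. -/
abbrev mapCyl {X Y : C} (f : X ⟶ Y) : C := pushout (cylIncl P 0 X) f

/-- The inclusion of the free end of the mapping cylinder. -/
def mapCylIncl {X Y : C} (f : X ⟶ Y) : X ⟶ mapCyl P f := cylIncl P 1 X ≫ pushout.inl _ _

variable {P}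

/-- A section handles the end `Y`. On the cylinder, homotopy lifting starts from the free end;
composing it with the vertical deformation, both run at the same time, makes it match the section at
the other end. -/
lemma strongHCofibrations_mapCylIncl {X Y : C} (f : X ⟶ Y) :
    strongHCofibrations P C (mapCylIncl P f) := by
  rintro E B p ⟨hp, hp'⟩
  refine ⟨fun {e b} sq => ?_⟩
  obtain ⟨s, hs, v⟩ := exists_section_of_hFibrations hp hp'
  obtain ⟨h, hh, h₀, h₁, hv⟩ := v
  have hβ := (isPath_cylIncl (P := P) X).postcomp (pushout.inl _ _ ≫ b)
  obtain ⟨δ, hδ, δ₀, δp⟩ := (hFibrations_iff p).1 hp e _ hβ.symm (by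
    simpa [mapCylIncl] using sq.w.symm)
  -- At time `t` this is `δ (1 - t) ≫ h t`: at `t = 1` it is `e`, at `t = 0` it has been moved onto
  -- the section.
  obtain ⟨g, hg⟩ := exists_cyl_desc (hδ.symm.comp hh)
  have hg₀ : cylIncl P 0 X ≫ g = f ≫ pushout.inr _ _ ≫ b ≫ s := by
    have := δp 1
    rw [symm_one] at this
    rw [hg, h₀, symm_zero, reassoc_of% this, pushout.condition_assoc]
  refine ⟨⟨pushout.desc g (pushout.inr _ _ ≫ b ≫ s) (by simpa using hg₀), ?_, ?_⟩⟩
  · rw [mapCylIncl, Category.assoc, pushout.inl_desc, hg, h₁, Category.comp_id, symm_one, δ₀]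
  · apply pushout.hom_ext
    · refine Tensor.hom_ext fun t => ?_
      rw [pushout.inl_desc_assoc, reassoc_of% (hg t), hv, Category.assoc, hs, Category.comp_id,
        δp, symm_symm]
    · rw [pushout.inr_desc_assoc, Category.assoc, Category.assoc, hs, Category.comp_id]

/-- Every map factors through its mapping cylinder as a strong `h`-cofibration followed by a
homotopy equivalence. -/
lemma exists_mapCyl_desc {X Y : C} (f : X ⟶ Y) :
    ∃ q : mapCyl P f ⟶ Y, mapCylIncl P f ≫ q = f ∧ homotopyEquivalences P C q := by
  obtain ⟨h, hh⟩ := exists_cyl_desc (isPath_const (P := P) f)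
  let q : mapCyl P f ⟶ Y := pushout.desc h (𝟙 Y) (by rw [hh, Category.comp_id])
  refine ⟨q, by rw [mapCylIncl, Category.assoc, pushout.inl_desc, hh], ?_⟩
  -- This inclusion is a pushout of a cylinder inclusion, hence a homotopy equivalence, and `q`
  -- retracts onto it.
  have h₁ : (hFibrations P C).llp (pushout.inr _ _ : Y ⟶ mapCyl P f) :=
    MorphismProperty.pushout_inr _ _ (llp_hFibrations_cylIncl X)
  refine (homotopyEquivalences P C).of_precomp _ q
    (llp_hFibrations_le_homotopyEquivalences h₁) ?_
  rw [pushout.inr_desc]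
  rw [homotopyEquivalences_eq]
  exact MorphismProperty.id_mem _ Y

end MappingCylinder

/-! ### The model structure, given one of the factorizations -/

section ModelStructure

open HomotopicalAlgebra MorphismProperty

variable (P : ObjectProperty TopCat.{w}) [ConvenientSpaces P]
  (C : Type u) [Category.{w} C] [TopologicallyBicomplete P C]

variable {P C} in
-- Retract argument: in the factorization of a strong `h`-cofibration that is a homotopy
-- equivalence, the fibration is also one by two-out-of-three, so the map is a retract of its left
-- factor.
lemma llp_hFibrations_eq [HasFactorization (hFibrations P C).llp (hFibrations P C)] :
    strongHCofibrations P C ⊓ homotopyEquivalences P C = (hFibrations P C).llp := by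
  ext A X j
  constructor
  · rintro ⟨hj, hj'⟩
    have φ := factorizationData (hFibrations P C).llp (hFibrations P C) j
    have := hj φ.p ⟨φ.hp, (homotopyEquivalences P C).of_precomp φ.i φ.p
      (llp_hFibrations_le_homotopyEquivalences φ.hi) (by rwa [φ.fac])⟩
    exact of_retract (RetractArrow.ofLeftLiftingProperty φ.fac) φ.hi
  · exact fun hj => ⟨fun E B p hp => hj p hp.1, llp_hFibrations_le_homotopyEquivalences hj⟩

/-- For the second factorization, only the projection of the mapping cylinder has to be factored:
its right factor is a homotopy equivalence by two-out-of-three, and its left factor is absorbed in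
the cofibration. -/
theorem exists_modelCategory [HasFactorization (hFibrations P C).llp (hFibrations P C)] :
    ∃ _ : ModelCategory C,
      weakEquivalences C = homotopyEquivalences P C ∧
      fibrations C = hFibrations P C ∧
      cofibrations C = strongHCofibrations P C := by
  let _ : CategoryWithFibrations C := ⟨hFibrations P C⟩
  let _ : CategoryWithCofibrations C := ⟨strongHCofibrations P C⟩
  let _ : CategoryWithWeakEquivalences C := ⟨homotopyEquivalences P C⟩
  have : (weakEquivalences C).HasTwoOutOfThreeProperty :=
    inferInstanceAs (homotopyEquivalences P C).HasTwoOutOfThreeProperty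
  have htc : trivialCofibrations C = (hFibrations P C).llp := llp_hFibrations_eq
  have : IsWeakFactorizationSystem (trivialCofibrations C) (fibrations C) := by
    rw [htc]
    exact ⟨rlp_llp_hFibrations, rfl, ‹_›⟩
  have : HasFactorization (cofibrations C) (trivialFibrations C) := ⟨fun {X Y} f => by
    obtain ⟨q, hq, hq'⟩ := exists_mapCyl_desc (P := P) f
    have φ := factorizationData (hFibrations P C).llp (hFibrations P C) q
    exact ⟨{
      Z := φ.Z
      i := mapCylIncl P f ≫ φ.i
      p := φ.p
      fac := by rw [Category.assoc, φ.fac, hq]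
      hi := (hFibrations P C ⊓ homotopyEquivalences P C).llp.comp_mem _ _
        (strongHCofibrations_mapCylIncl f) fun E B p hp => φ.hi p hp.1
      hp := ⟨φ.hp, (homotopyEquivalences P C).of_precomp φ.i φ.p
        (llp_hFibrations_le_homotopyEquivalences φ.hi) (by rwa [φ.fac])⟩ }⟩⟩
  have : (cofibrations C).IsStableUnderRetracts :=
    inferInstanceAs (hFibrations P C ⊓ homotopyEquivalences P C).llp.IsStableUnderRetracts
  have : (trivialFibrations C).IsStableUnderRetracts :=
    inferInstanceAs (hFibrations P C ⊓ homotopyEquivalences P C).IsStableUnderRetracts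
  have : IsWeakFactorizationSystem (cofibrations C) (trivialFibrations C) :=
    IsWeakFactorizationSystem.mk' _ _ fun i p hi hp => hi p hp
  exact ⟨ModelCategory.mk' C, rfl, rfl, rfl⟩

end ModelStructure


/-! ### Well-copowered factorization systems -/

section WellCopowered

variable {C : Type u} [Category.{w} C] {E M : MorphismProperty C}

lemma IsOrthogonalFactorizationSystem.hasLiftingProperty
    (h : IsOrthogonalFactorizationSystem E M) {A B X Y : C} {e : A ⟶ B} {m : X ⟶ Y}
    (he : E e) (hm : M m) : HasLiftingProperty e m := by
  rw [← h.isWeakFactorizationSystem.rlp] at hm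
  exact hm _ he

lemma IsOrthogonalFactorizationSystem.exists_lift
    (h : IsOrthogonalFactorizationSystem E M) {A B X Y : C} {e : A ⟶ B} {m : X ⟶ Y}
    (he : E e) (hm : M m) {u : A ⟶ X} {v : B ⟶ Y} (w : u ≫ m = e ≫ v) :
    ∃ l : B ⟶ X, e ≫ l = u ∧ l ≫ m = v := by
  have := h.hasLiftingProperty he hm
  have sq : CommSq u e m v := ⟨w⟩
  exact ⟨sq.lift, sq.fac_left, sq.fac_right⟩

/-- In a cocomplete category, the left class of a well-copowered orthogonal factorization system
consists of epimorphisms. -/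
lemma IsOrthogonalFactorizationSystem.epi [HasColimits C]
    (h : IsOrthogonalFactorizationSystem E M) (hE : IsWellCopowered E) {A B : C} {e : A ⟶ B}
    (he : E e) : Epi e := by
  classical
  refine ⟨fun {T} a b hab => by_contra fun hne => ?_⟩
  obtain ⟨ι, Q, q, hq⟩ := hE A
  -- A set large enough to contain all maps to `T` from all `E`-quotients of `A`. The wide pushout
  -- of `J` copies of `e` will be one of these quotients.
  let J := Σ i, (Q i ⟶ T)
  let W := widePushout A (fun _ : J => B) fun _ => e
  have hι (j : J) : e ≫ WidePushout.ι (fun _ : J => e) j = WidePushout.head fun _ : J => e :=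
    WidePushout.arrow_ι (objs := fun _ : J => B) (fun _ => e) j
  have hW : E (WidePushout.head fun _ : J => e) := by
    rw [← h.isWeakFactorizationSystem.llp]
    intro X Y m hm
    refine ⟨fun {s t} sq => ?_⟩
    have key (j : J) : ∃ l : B ⟶ X, e ≫ l = s ∧ l ≫ m = WidePushout.ι (fun _ : J => e) j ≫ t :=
      h.exists_lift he hm (by rw [sq.w, reassoc_of% (hι j)])
    choose l hl hl' using key
    refine ⟨⟨WidePushout.desc s l hl, WidePushout.head_desc _ _ _ _, ?_⟩⟩
    apply WidePushout.hom_ext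
    · intro j
      rw [WidePushout.ι_desc_assoc, hl']
    · rw [WidePushout.head_desc_assoc, sq.w]
  obtain ⟨i, φ, -⟩ := hq _ _ hW
  -- If `a ≠ b`, choosing `a` or `b` on each copy gives a distinct map for each subset of `J`,
  -- contradicting Cantor's theorem.
  let d (S : Set J) : W ⟶ T :=
    WidePushout.desc (e ≫ a) (fun j => if j ∈ S then a else b)
      (by intro j; split_ifs <;> simp [hab])
  refine Function.cantor_injective (fun S : Set J => (⟨i, φ.hom ≫ d S⟩ : J)) fun S S' hS => ?_
  have hd : d S = d S' := (cancel_epi φ.hom).1 (eq_of_heq (Sigma.mk.inj hS).2)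
  ext j
  have := congr(WidePushout.ι (fun _ : J => e) j ≫ $hd)
  simp only [d, WidePushout.ι_desc] at this
  split_ifs at this with h₁ h₂ h₂
  · simp [h₁, h₂]
  · exact absurd this hne
  · exact absurd this.symm hne
  · simp [h₁, h₂]

end WellCopowered

/-! ### Partial algebras for a pointed endofunctor -/

/-- A partial algebra for the endofunctor `T`: an object `dom`, together with a partial
structure map `T dom ⟶ cod`. -/
structure PartialAlgebra {C : Type u} [Category.{w} C] (T : C ⥤ C) where
  dom : C
  cod : C
  str : T.obj dom ⟶ cod

namespace PartialAlgebra

variable {C : Type u} [Category.{w} C] {T : C ⥤ C}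

/-- Morphisms of partial algebras. -/
@[ext]
structure Hom (d d' : PartialAlgebra T) where
  dom : d.dom ⟶ d'.dom
  cod : d.cod ⟶ d'.cod
  w : T.map dom ≫ d'.str = d.str ≫ cod

instance : Category (PartialAlgebra T) where
  Hom := Hom
  id d := ⟨𝟙 _, 𝟙 _, by simp⟩
  comp f g := ⟨f.dom ≫ g.dom, f.cod ≫ g.cod, by
    rw [T.map_comp, Category.assoc, g.w, reassoc_of% f.w]⟩

@[ext]
lemma hom_ext {d d' : PartialAlgebra T} {f g : d ⟶ d'} (h₁ : f.dom = g.dom)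
    (h₂ : f.cod = g.cod) : f = g :=
  Hom.ext h₁ h₂

@[simp]
lemma id_dom (d : PartialAlgebra T) : Hom.dom (𝟙 d) = 𝟙 d.dom := rfl

@[simp]
lemma id_cod (d : PartialAlgebra T) : Hom.cod (𝟙 d) = 𝟙 d.cod := rfl

@[simp]
lemma comp_dom {d d' d'' : PartialAlgebra T} (f : d ⟶ d') (g : d' ⟶ d'') :
    (f ≫ g).dom = f.dom ≫ g.dom := rfl

@[simp]
lemma comp_cod {d d' d'' : PartialAlgebra T} (f : d ⟶ d') (g : d' ⟶ d'') :
    (f ≫ g).cod = f.cod ≫ g.cod := rfl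

lemma hom_w {d d' : PartialAlgebra T} (f : d ⟶ d') :
    T.map f.dom ≫ d'.str = d.str ≫ f.cod := f.w

lemma hom_w_assoc {d d' : PartialAlgebra T} (f : d ⟶ d') {Z : C} (g : d'.cod ⟶ Z) :
    T.map f.dom ≫ d'.str ≫ g = d.str ≫ f.cod ≫ g := by
  rw [← Category.assoc, hom_w, Category.assoc]

variable (T) in
/-- The underlying object of a partial algebra. -/
abbrev domFunctor : PartialAlgebra T ⥤ C where
  obj d := d.dom
  map f := f.dom

variable (T) in
/-- The codomain of the partial structure map. -/
abbrev codFunctor : PartialAlgebra T ⥤ C where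
  obj d := d.cod
  map f := f.cod

section Colimits

variable [HasColimits C] {J : Type w} [Category.{w} J] (F : J ⥤ PartialAlgebra T)

/-- The comparison map from the colimit of the `T dom`. -/
def colimComparison : colimit (F ⋙ domFunctor T ⋙ T) ⟶ T.obj (colimit (F ⋙ domFunctor T)) :=
  colimit.desc (F ⋙ domFunctor T ⋙ T) (T.mapCocone (colimit.cocone (F ⋙ domFunctor T)))

/-- The colimit of the structure maps. -/
def colimStr : colimit (F ⋙ domFunctor T ⋙ T) ⟶ colimit (F ⋙ codFunctor T) :=
  colimMap
    { app j := (F.obj j).str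
      naturality _ _ f := hom_w (F.map f) }

lemma ι_colimComparison (j : J) : colimit.ι (F ⋙ domFunctor T ⋙ T) j ≫ colimComparison F =
    T.map (colimit.ι (F ⋙ domFunctor T) j) :=
  colimit.ι_desc (T.mapCocone (colimit.cocone (F ⋙ domFunctor T))) j

lemma ι_colimComparison_assoc (j : J) {Z : C} (g : T.obj (colimit (F ⋙ domFunctor T)) ⟶ Z) :
    colimit.ι (F ⋙ domFunctor T ⋙ T) j ≫ colimComparison F ≫ g =
      T.map (colimit.ι (F ⋙ domFunctor T) j) ≫ g := by
  rw [← Category.assoc, ι_colimComparison]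

lemma ι_colimStr (j : J) : colimit.ι (F ⋙ domFunctor T ⋙ T) j ≫ colimStr F =
    (F.obj j).str ≫ colimit.ι (F ⋙ codFunctor T) j :=
  ι_colimMap _ _

lemma ι_colimStr_assoc (j : J) {Z : C} (g : colimit (F ⋙ codFunctor T) ⟶ Z) :
    colimit.ι (F ⋙ domFunctor T ⋙ T) j ≫ colimStr F ≫ g =
      (F.obj j).str ≫ colimit.ι (F ⋙ codFunctor T) j ≫ g := by
  rw [← Category.assoc, ι_colimStr, Category.assoc]

lemma map_ι_inl (j : J) :
    T.map (colimit.ι (F ⋙ domFunctor T) j) ≫ pushout.inl (colimComparison F) (colimStr F) =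
      (F.obj j).str ≫ colimit.ι (F ⋙ codFunctor T) j ≫ pushout.inr _ _ := by
  rw [← ι_colimComparison, Category.assoc, pushout.condition, ι_colimStr_assoc]

/-- The colimit of a diagram of partial algebras. -/
abbrev colimObj : PartialAlgebra T :=
  -- `T` need not preserve the colimit of the domains, so the colimit of the codomains is enlarged
  -- to receive `T` of that colimit.
  ⟨colimit (F ⋙ domFunctor T), pushout (colimComparison F) (colimStr F), pushout.inl _ _⟩

/-- The legs of the colimit cocone of partial algebras. -/
abbrev colimLeg (j : J) : F.obj j ⟶ colimObj F :=
  ⟨colimit.ι (F ⋙ domFunctor T) j, colimit.ι (F ⋙ codFunctor T) j ≫ pushout.inr _ _,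
    map_ι_inl F j⟩

/-- The colimit cocone of a diagram of partial algebras. -/
def colimCocone : Cocone F where
  pt := colimObj F
  ι := {
    app := colimLeg F
    naturality i j f := by
      rw [Functor.const_obj_map]
      refine Eq.trans ?_ (Category.comp_id _).symm
      apply hom_ext
      · exact colimit.w (F ⋙ domFunctor T) f
      · exact colimit.w_assoc (F ⋙ codFunctor T) f _ }

variable {F} in
/-- The first component of a map out of a colimit of partial algebras. -/
def colimDescDom (s : Cocone F) : colimit (F ⋙ domFunctor T) ⟶ s.pt.dom :=
  colimit.desc (F ⋙ domFunctor T) ((domFunctor T).mapCocone s)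

variable {F} in
/-- The second component of a map out of a colimit of partial algebras, before gluing. -/
def colimDescCod (s : Cocone F) : colimit (F ⋙ codFunctor T) ⟶ s.pt.cod :=
  colimit.desc (F ⋙ codFunctor T) ((codFunctor T).mapCocone s)

variable {F} in
lemma ι_colimDescDom (s : Cocone F) (j : J) :
    colimit.ι (F ⋙ domFunctor T) j ≫ colimDescDom s = (s.ι.app j).dom :=
  colimit.ι_desc _ _

variable {F} in
lemma ι_colimDescCod (s : Cocone F) (j : J) :
    colimit.ι (F ⋙ codFunctor T) j ≫ colimDescCod s = (s.ι.app j).cod :=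
  colimit.ι_desc _ _

variable {F} in
lemma colimDesc_w (s : Cocone F) : colimComparison F ≫ T.map (colimDescDom s) ≫ s.pt.str =
    colimStr F ≫ colimDescCod s := by
  apply colimit.hom_ext
  intro j
  rw [ι_colimComparison_assoc, ι_colimStr_assoc, ι_colimDescCod, ← T.map_comp_assoc,
    ι_colimDescDom]
  exact hom_w (s.ι.app j)

/-- The colimit cocone of partial algebras is a colimit. -/
def isColimitColimCocone : IsColimit (colimCocone F) where
  desc s := {
    dom := colimDescDom s
    cod := pushout.desc (T.map (colimDescDom s) ≫ s.pt.str) (colimDescCod s) (colimDesc_w s)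
    w := (pushout.inl_desc _ _ _).symm }
  fac s j := by
    apply hom_ext
    · exact ι_colimDescDom s j
    · exact (Category.assoc _ _ _).trans
        ((congrArg _ (pushout.inr_desc _ _ _)).trans (ι_colimDescCod s j))
  uniq s m hm := by
    have h₁ : m.dom = colimDescDom s := by
      apply colimit.hom_ext
      intro j
      exact (congr($(hm j).dom) : _).trans (ι_colimDescDom s j).symm
    apply hom_ext
    · exact h₁
    · apply pushout.hom_ext
      · refine (hom_w m).symm.trans ?_
        rw [h₁]
        exact (pushout.inl_desc _ _ _).symm
      · refine Eq.trans ?_ (pushout.inr_desc _ _ _).symm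
        apply colimit.hom_ext
        intro j
        refine Eq.trans ?_ (ι_colimDescCod s j).symm
        exact (Category.assoc _ _ _).symm.trans congr($(hm j).cod)

instance : HasColimits (PartialAlgebra T) where
  has_colimits_of_shape _ _ := { has_colimit F := ⟨_, isColimitColimCocone F⟩ }

instance : PreservesColimit F (domFunctor T) :=
  preservesColimit_of_preserves_colimit_cocone (isColimitColimCocone F)
    (IsColimit.ofIsoColimit (colimit.isColimit (F ⋙ domFunctor T)) (Cocone.ext (Iso.refl _)
      fun _ => Category.comp_id _))

end Colimits

variable (η : 𝟭 C ⟶ T)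

/-- The map `dom ⟶ cod` given by the partial structure map and the point of `T`. -/
def incl (d : PartialAlgebra T) : d.dom ⟶ d.cod := η.app d.dom ≫ d.str

lemma incl_naturality {d d' : PartialAlgebra T} (f : d ⟶ d') :
    f.dom ≫ d'.incl η = d.incl η ≫ f.cod := by
  have := η.naturality f.dom
  dsimp at this
  rw [incl, incl, reassoc_of% this, hom_w, Category.assoc]

lemma incl_naturality_assoc {d d' : PartialAlgebra T} (f : d ⟶ d') {Z : C} (g : d'.cod ⟶ Z) :
    f.dom ≫ d'.incl η ≫ g = d.incl η ≫ f.cod ≫ g := by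
  rw [← Category.assoc, incl_naturality, Category.assoc]

section Extension

/-- The class of morphisms between total algebras. -/
def totalMaps : MorphismProperty (PartialAlgebra T) :=
  fun d d' _ => IsIso (d.incl η) ∧ IsIso (d'.incl η)

/-- The class of morphisms of partial algebras with the left lifting property with respect to
morphisms of total algebras. -/
def extensions : MorphismProperty (PartialAlgebra T) := (totalMaps η).llp

variable {η}

instance : (extensions η).IsMultiplicative := by
  unfold extensions
  infer_instance

instance : MorphismProperty.IsStableUnderTransfiniteComposition.{w} (extensions η) := by
  unfold extensions
  infer_instance

variable [HasColimits C]

lemma extensions_head {d : PartialAlgebra T} {ι : Type w}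
    {d' : ι → PartialAlgebra T} {f : ∀ i, d ⟶ d' i} (hf : ∀ i, extensions η (f i)) :
    extensions η (WidePushout.head f) := by
  intro x x' p hp
  refine ⟨fun {h k} sq => ?_⟩
  have sq' (i : ι) : CommSq h (f i) p (WidePushout.ι f i ≫ k) :=
    ⟨by rw [sq.w, ← Category.assoc, WidePushout.arrow_ι]⟩
  have _ (i : ι) := hf i p hp
  refine ⟨⟨WidePushout.desc h (fun i => (sq' i).lift) fun i => (sq' i).fac_left,
    WidePushout.head_desc _ _ _ _, ?_⟩⟩
  apply WidePushout.hom_ext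
  · intro i
    rw [WidePushout.ι_desc_assoc, (sq' i).fac_right]
  · rw [WidePushout.head_desc_assoc, sq.w]

variable (η) in
/-- One step in the construction of the free algebra: the structure map is extended to `cod`. -/
abbrev step (d : PartialAlgebra T) : PartialAlgebra T :=
  ⟨d.cod, coequalizer (T.map (d.incl η)) (d.str ≫ η.app d.cod), coequalizer.π _ _⟩

variable (η) in
/-- The map of a partial algebra to its extension. -/
abbrev toStep (d : PartialAlgebra T) : d ⟶ d.step η :=
  ⟨d.incl η, η.app d.cod ≫ coequalizer.π _ _, by
    rw [← Category.assoc]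
    exact coequalizer.condition _ _⟩

lemma exists_step_desc {d x : PartialAlgebra T} [IsIso (x.incl η)] (h : d ⟶ x) :
    ∃ g : d.step η ⟶ x, d.toStep η ≫ g = h ∧ g.dom = h.cod ≫ inv (x.incl η) := by
  have h₁ : h.dom = d.incl η ≫ h.cod ≫ inv (x.incl η) := by
    rw [← incl_naturality_assoc, IsIso.hom_inv_id, Category.comp_id]
  have h₂ : η.app d.cod ≫ T.map (h.cod ≫ inv (x.incl η)) ≫ x.str = h.cod := by
    have := η.naturality (h.cod ≫ inv (x.incl η))
    dsimp at this
    rw [← reassoc_of% this, ← incl, IsIso.inv_hom_id, Category.comp_id]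
  refine ⟨⟨h.cod ≫ inv (x.incl η),
    coequalizer.desc (T.map (h.cod ≫ inv (x.incl η)) ≫ x.str) ?_,
    (coequalizer.π_desc _ _).symm⟩, ?_, rfl⟩
  · rw [← T.map_comp_assoc, ← h₁, hom_w, Category.assoc, h₂]
  · ext
    · exact h₁.symm
    · change (η.app d.cod ≫ coequalizer.π _ _) ≫ coequalizer.desc _ _ = _
      rw [Category.assoc, coequalizer.π_desc, h₂]

/-- The structure map of `d.step η` is a coequalizer projection, hence epi. -/
lemma step_hom_ext {d x : PartialAlgebra T} {f g : d.step η ⟶ x} (h : f.dom = g.dom) :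
    f = g := by
  apply hom_ext h
  apply coequalizer.hom_ext
  exact (hom_w f).symm.trans (congr(T.map $h ≫ x.str).trans (hom_w g))

lemma extensions_toStep (d : PartialAlgebra T) : extensions η (d.toStep η) := by
  rintro x x' p ⟨hx, hx'⟩
  refine ⟨fun {h k} sq => ?_⟩
  obtain ⟨g, hg, hg'⟩ := exists_step_desc (η := η) h
  refine ⟨⟨g, hg, step_hom_ext ?_⟩⟩
  have hk : (d.step η).incl η ≫ k.cod = h.cod ≫ p.cod := congr($(sq.w).cod).symm
  rw [← cancel_mono (x'.incl η), incl_naturality η k, hk, comp_dom, Category.assoc, incl_naturality,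
    hg', Category.assoc, IsIso.inv_hom_id_assoc]

variable (η) in
/-- The class of extensions `w : d ⟶ d'` of partial algebras, through which the structure map of
`d` becomes total, and such that the `E`-image of `dom` in any further extension is already
defined in `d'`. -/
structure Stabilization (E : MorphismProperty C) {d d' : PartialAlgebra T} (w : d ⟶ d') :
    Prop where
  extensions : extensions η w
  exists_retraction : ∃ s : d.cod ⟶ d'.dom, d.incl η ≫ s = w.dom ∧ s ≫ d'.incl η = w.cod
  exists_image ⦃d'' : PartialAlgebra T⦄ (v : d' ⟶ d'') (hv : PartialAlgebra.extensions η v)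
    ⦃Z : C⦄ (e : d.dom ⟶ Z) (m : Z ⟶ d''.dom) (he : E e) (hm : e ≫ m = (w ≫ v).dom) :
    ∃ r : Z ⟶ d'.dom, e ≫ r = w.dom

/-- For each of the set of `E`-quotients of `d.dom` through which some extension of `d` factors on
domains, choose one such extension. The wide pushout of these and of `d.toStep η` performs all of
them at once. -/
lemma exists_stabilization {E : MorphismProperty C} (hE : IsWellCopowered E)
    (d : PartialAlgebra T) :
    ∃ (d' : PartialAlgebra T) (w : d ⟶ d'), Stabilization η E w := by
  obtain ⟨ι, Q, q, hq⟩ := hE d.dom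
  let R (i : ι) : Prop := ∃ (d' : PartialAlgebra T) (v : d ⟶ d') (r : Q i ⟶ d'.dom),
    extensions η v ∧ q i ≫ r = v.dom
  choose D v r hv hr using fun i : Subtype R => i.2
  let D' : Option (Subtype R) → PartialAlgebra T := fun o => o.elim (d.step η) D
  let v' : ∀ o, d ⟶ D' o := fun o => match o with
    | none => d.toStep η
    | some i => v i
  have hv' (o) : extensions η (v' o) := match o with
    | none => extensions_toStep d
    | some i => hv i
  let s : d.step η ⟶ widePushout d D' v' := WidePushout.ι v' none
  have hs : d.toStep η ≫ s = WidePushout.head v' := WidePushout.arrow_ι v' none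
  let t (i : Subtype R) : D i ⟶ widePushout d D' v' := WidePushout.ι v' (some i)
  have ht (i : Subtype R) : v i ≫ t i = WidePushout.head v' := WidePushout.arrow_ι v' (some i)
  have hhead := extensions_head hv'
  refine ⟨_, WidePushout.head v', hhead, ⟨s.dom, ?_, ?_⟩, ?_⟩
  · rw [← hs]
    rfl
  · rw [← hs]
    exact incl_naturality η s
  · intro d'' u hu Z e m he hm
    obtain ⟨i, φ, rfl⟩ := hq Z e he
    -- The later extension `d''` witnesses `R i`, so an extension realizing this quotient was
    -- already glued in.
    let j : Subtype R := ⟨i, d'', WidePushout.head v' ≫ u, φ.hom ≫ m,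
      (extensions η).comp_mem _ _ hhead hu, by rw [← hm, Category.assoc]⟩
    refine ⟨φ.inv ≫ r j ≫ (t j).dom, ?_⟩
    rw [Category.assoc, Iso.hom_inv_id_assoc, ← ht j, comp_dom, ← hr j, Category.assoc]

end Extension

section Chain

variable {J : Type w} [LinearOrder J] [SuccOrder J]

/-- A chain of partial algebras whose structure maps successively become total, and in which
`E`-images stabilize, converges to an algebra. -/
lemma exists_algebra_of_chain {E M : MorphismProperty C} (h : IsOrthogonalFactorizationSystem E M)
    (hE : ∀ ⦃A B : C⦄ (e : A ⟶ B), E e → Epi e)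
    (hT : ∀ (F : J ⥤ C) (c : Cocone F), IsColimit c → (∀ j, M (c.ι.app j)) →
      Nonempty (IsColimit (T.mapCocone c)))
    (F : J ⥤ PartialAlgebra T) (c : Cocone (F ⋙ domFunctor T)) (hc : IsColimit c)
    (s : ∀ j, (F.obj j).cod ⟶ (F.obj (Order.succ j)).dom)
    (hs : ∀ j, (F.obj j).incl η ≫ s j = (F.map (homOfLE (Order.le_succ j))).dom)
    (hs' : ∀ j, s j ≫ (F.obj (Order.succ j)).incl η = (F.map (homOfLE (Order.le_succ j))).cod)
    (hr : ∀ (j : J) ⦃Z : C⦄ (e : (F.obj j).dom ⟶ Z) (m : Z ⟶ c.pt), E e → e ≫ m = c.ι.app j →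
      ∃ r : Z ⟶ (F.obj (Order.succ j)).dom,
        e ≫ r = (F.map (homOfLE (Order.le_succ j))).dom) :
    ∃ (a : T.obj c.pt ⟶ c.pt) (t : Cocone F) (ht : t.pt = ⟨c.pt, c.pt, a⟩),
      η.app c.pt ≫ a = 𝟙 c.pt ∧ ∀ j, (t.ι.app j ≫ eqToHom ht).dom = c.ι.app j := by
  have := h.isWeakFactorizationSystem
  let ℓ (j : J) : (F.obj j).dom ⟶ c.pt := c.ι.app j
  have hℓ {i j : J} (f : i ⟶ j) : (F.map f).dom ≫ ℓ j = ℓ i := c.w f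
  have hFc {i j k : J} (f : i ⟶ j) (g : j ⟶ k) :
      (F.map f).dom ≫ (F.map g).dom = (F.map (f ≫ g)).dom := by rw [F.map_comp, comp_dom]
  -- the `E`-images of the objects of the chain
  let φ (j : J) := MorphismProperty.factorizationData E M (ℓ j)
  have hφ (j : J) : (φ j).i ≫ (φ j).p = ℓ j := (φ j).fac
  have hepi (j : J) : Epi (φ j).i := hE _ (φ j).hi
  have hz {i j : J} (f : i ⟶ j) : ∃ z : (φ i).Z ⟶ (φ j).Z,
      (φ i).i ≫ z = (F.map f).dom ≫ (φ j).i ∧ z ≫ (φ j).p = (φ i).p :=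
    h.exists_lift (φ i).hi (φ j).hp (by rw [Category.assoc, hφ, hφ, hℓ])
  choose z hz₁ hz₂ using @hz
  let Z : J ⥤ C := {
    obj j := (φ j).Z
    map f := z f
    map_id j := by
      rw [← cancel_epi (φ j).i, hz₁, F.map_id, id_dom, Category.id_comp, Category.comp_id]
    map_comp {i j k} f g := by
      rw [← cancel_epi (φ i).i, hz₁, reassoc_of% (hz₁ f), hz₁, ← hFc, Category.assoc] }
  let cZ : Cocone Z := {
    pt := c.pt
    ι := {
      app j := (φ j).p
      naturality i j f := (hz₂ f).trans (Category.comp_id _).symm } }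
  let cocone_of (t : Cocone Z) : Cocone (F ⋙ domFunctor T) := {
    pt := t.pt
    ι := {
      app j := (φ j).i ≫ t.ι.app j
      naturality i j f := by
        have := t.w f
        refine Eq.trans ?_ (Category.comp_id _).symm
        rw [← this]
        exact (Category.assoc _ _ _).symm.trans
          ((congr($(hz₁ f) ≫ t.ι.app j)).symm.trans (Category.assoc _ _ _)) } }
  -- The maps to the images are epi, so the chain of images has the same colimit; its legs lie in
  -- `M`, which makes `hT` applicable.
  let hcZ : IsColimit cZ := {
    desc t := hc.desc (cocone_of t)
    fac t j := by
      rw [← cancel_epi (φ j).i]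
      exact (Category.assoc _ _ _).symm.trans
        ((congr($(hφ j) ≫ hc.desc (cocone_of t))).trans (hc.fac (cocone_of t) j))
    uniq t m hm := hc.uniq (cocone_of t) m fun j => by
      have := congr((φ j).i ≫ $(hm j))
      rw [← Category.assoc] at this
      exact (congr($(hφ j) ≫ m)).symm.trans this }
  obtain ⟨hcT⟩ := hT Z cZ hcZ fun j => (φ j).hp
  -- the algebra structure
  choose r hr' using fun j => hr j (φ j).i (φ j).p (φ j).hi (hφ j)
  let g (j : J) : (F.obj j).cod ⟶ c.pt := s j ≫ ℓ (Order.succ j)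
  -- For `i < j` the transition map on codomains passes through stage `succ i`, where the codomain
  -- of stage `i` has already been absorbed by `s i`.
  have hg {i j : J} (f : i ⟶ j) : (F.map f).cod ≫ g j = g i := by
    obtain rfl | hlt := (leOfHom f).eq_or_lt
    · obtain rfl : f = 𝟙 i := Subsingleton.elim _ _
      rw [F.map_id, id_cod, Category.id_comp]
    · let f' : Order.succ i ⟶ j := homOfLE (Order.succ_le_of_lt hlt)
      obtain rfl : f = homOfLE (Order.le_succ i) ≫ f' := Subsingleton.elim _ _
      rw [F.map_comp, comp_cod, ← hs', Category.assoc, Category.assoc, ← incl_naturality_assoc,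
        reassoc_of% (hs j), hℓ, hℓ]
  let b (j : J) : T.obj (φ j).Z ⟶ c.pt :=
    T.map (r j) ≫ (F.obj (Order.succ j)).str ≫ g (Order.succ j)
  -- The maps `r` out of the images are compatible because this can be checked after the epi from
  -- stage `i`.
  have hb {i j : J} (f : i ⟶ j) : T.map (z f) ≫ b j = b i := by
    let f' : Order.succ i ⟶ Order.succ j := homOfLE (Order.succ_le_succ (leOfHom f))
    have hrz : z f ≫ r j = r i ≫ (F.map f').dom := by
      rw [← cancel_epi (φ i).i, reassoc_of% (hz₁ f), hr', reassoc_of% (hr' i), hFc, hFc]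
      rfl
    rw [← T.map_comp_assoc, hrz, T.map_comp, Category.assoc, hom_w_assoc, hg]
  let cb : Cocone (Z ⋙ T) := {
    pt := c.pt
    ι := {
      app j := b j
      naturality i j f := (hb f).trans (Category.comp_id _).symm } }
  have hfac (j : J) : T.map (φ j).p ≫ hcT.desc cb = b j := hcT.fac cb j
  have hℓa (j : J) : T.map (ℓ j) ≫ hcT.desc cb = (F.obj j).str ≫ g j := by
    rw [← hφ, T.map_comp, Category.assoc, hfac, ← T.map_comp_assoc, hr', hom_w_assoc, hg]
  let t : Cocone F := {
    pt := ⟨c.pt, c.pt, hcT.desc cb⟩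
    ι := {
      app j := ⟨ℓ j, g j, hℓa j⟩
      naturality i j f := by
        refine Eq.trans ?_ (Category.comp_id _).symm
        exact hom_ext (hℓ f) (hg f) } }
  refine ⟨hcT.desc cb, t, rfl, hc.hom_ext fun j => ?_, fun j => Category.comp_id _⟩
  change ℓ j ≫ η.app c.pt ≫ _ = ℓ j ≫ 𝟙 _
  have hη : η.app (φ j).Z ≫ b j = r j ≫ (F.obj (Order.succ j)).incl η ≫ g (Order.succ j) := by
    have := η.naturality (r j)
    dsimp at this
    rw [incl, Category.assoc, reassoc_of% this]
  have hη' : (φ j).p ≫ η.app c.pt = η.app (φ j).Z ≫ T.map (φ j).p := η.naturality (φ j).p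
  rw [← hφ, Category.assoc, reassoc_of% hη', hfac, hη, reassoc_of% (hr' j), reassoc_of% (hs _), hℓ,
    hℓ, Category.comp_id, hφ]

end Chain

/-- Kelly's construction: a pointed endofunctor which preserves suitable colimits of chains admits
free algebras. -/
theorem exists_free_algebra [HasColimits C] {E M : MorphismProperty C}
    (h : IsOrthogonalFactorizationSystem E M) (hE : IsWellCopowered E)
    {α : Cardinal.{w}} (hα : α.IsRegular)
    (hT : ∀ (F : α.ord.ToType ⥤ C) (c : Cocone F), IsColimit c → (∀ j, M (c.ι.app j)) →
      Nonempty (IsColimit (T.mapCocone c))) (X : C) :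
    ∃ (A : C) (x : X ⟶ A) (a : T.obj A ⟶ A), η.app A ≫ a = 𝟙 A ∧
      ∀ ⦃W : C⦄ (w : T.obj W ⟶ W), η.app W ≫ w = 𝟙 W → ∀ q : W ⟶ A, T.map q ≫ a = w ≫ q →
        ∀ u : X ⟶ W, u ≫ q = x → ∃ v : A ⟶ W, x ≫ v = u ∧ v ≫ q = 𝟙 A := by
  choose succ toSucc hsucc using exists_stabilization (T := T) (η := η) hE
  -- The iteration starts at the free partial algebra on `X`; a map from it to a partial algebra is
  -- just a map from `X` to the domain.
  let Φ : SmallObject.SuccStruct (PartialAlgebra T) :=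
    { X₀ := ⟨X, T.obj X, 𝟙 _⟩, succ := succ, toSucc := toSucc }
  have : Nonempty α.ord.ToType := by simpa using hα.ne_zero
  let _ := WellFoundedLT.toOrderBot α.ord.ToType
  let _ := SuccOrder.ofLinearWellFoundedLT α.ord.ToType
  have : NoMaxOrder α.ord.ToType := Cardinal.noMaxOrder hα.aleph0_le
  have hprop {d d' : PartialAlgebra T} (f : d ⟶ d') (hf : Φ.prop f) : Stabilization η E f := by
    obtain ⟨d⟩ := hf
    exact hsucc d
  let F := Φ.iterationFunctor α.ord.ToType
  have hF (j) : Stabilization η E (F.map (homOfLE (Order.le_succ j))) :=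
    hprop _ (Φ.prop_iterationFunctor_map_succ j (not_isMax j))
  let ht := (Φ.transfiniteCompositionOfShapeιIteration α.ord.ToType).ofLE
    (W' := extensions η) fun _ _ f hf => (hprop f hf).extensions
  choose s hs hs' using fun j => (hF j).exists_retraction
  let c := (domFunctor T).mapCocone (Φ.iterationCocone α.ord.ToType)
  have hincl (j) : extensions η ((Φ.iterationCocone α.ord.ToType).ι.app j) := ht.mem_incl_app j
  have hw (j) : F.map (homOfLE (Order.le_succ j)) ≫
      (Φ.iterationCocone α.ord.ToType).ι.app (Order.succ j) =
      (Φ.iterationCocone α.ord.ToType).ι.app j :=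
    (Φ.iterationCocone α.ord.ToType).w (homOfLE (Order.le_succ j))
  have hc := isColimitOfPreserves (domFunctor T) (Φ.isColimitIterationCocone α.ord.ToType)
  obtain ⟨a, t, ht', ha, hta⟩ := exists_algebra_of_chain η h (fun A B e he => h.epi hE he) hT F c
    hc s hs hs'
    fun j Z e m he hm => (hF j).exists_image ((Φ.iterationCocone α.ord.ToType).ι.app (Order.succ j))
      (hincl _) e m he (hm.trans congr(Hom.dom $(hw j)).symm)
  let k : Φ.iteration α.ord.ToType ⟶ ⟨c.pt, c.pt, a⟩ :=
    (Φ.isColimitIterationCocone α.ord.ToType).desc t ≫ eqToHom ht'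
  have hk : k.dom = 𝟙 c.pt := hc.hom_ext fun j => by
    have : (Φ.iterationCocone α.ord.ToType).ι.app j ≫ k = t.ι.app j ≫ eqToHom ht' :=
      (Φ.isColimitIterationCocone α.ord.ToType).fac_assoc t j _
    exact (congr(Hom.dom $this).trans (hta j)).trans (Category.comp_id _).symm
  have hx : extensions η (Φ.ιIteration α.ord.ToType) :=
    (extensions η).transfiniteCompositionsOfShape_le _ _ ht.mem
  let x : X ⟶ c.pt := (Φ.ιIteration α.ord.ToType).dom
  refine ⟨c.pt, x, a, ha, fun W w hw q hq u hu => ?_⟩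
  let W' : PartialAlgebra T := ⟨W, W, w⟩
  let A' : PartialAlgebra T := ⟨c.pt, c.pt, a⟩
  let u' : Φ.X₀ ⟶ W' := ⟨u, T.map u ≫ w, (Category.id_comp _).symm⟩
  let q' : W' ⟶ A' := ⟨q, q, hq⟩
  have hW' : W'.incl η = 𝟙 W := hw
  have hA' : A'.incl η = 𝟙 c.pt := ha
  -- Both algebras are total, so the transfinite composite of extensions lifts against `q'`; since
  -- `k` is the identity on domains, the lift is a section of `q`.
  have := hx q' ⟨by rw [hW']; infer_instance, by rw [hA']; infer_instance⟩
  have hxk : (Φ.ιIteration α.ord.ToType ≫ k).dom = x := by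
    rw [comp_dom, hk]
    exact Category.comp_id x
  have hxk' : T.map x ≫ a = (Φ.ιIteration α.ord.ToType ≫ k).cod := by
    rw [← hxk]
    exact (hom_w (Φ.ιIteration α.ord.ToType ≫ k)).trans (Category.id_comp _)
  have sq : CommSq u' (Φ.ιIteration α.ord.ToType) q' k := ⟨by
    apply hom_ext
    · exact hu.trans hxk.symm
    · refine Eq.trans ?_ hxk'
      change (T.map u ≫ w) ≫ q = _
      rw [Category.assoc, ← hq, ← T.map_comp_assoc, hu]⟩
  exact ⟨sq.lift.dom, congr(Hom.dom $(sq.fac_left)), congr(Hom.dom $(sq.fac_right)).trans hk⟩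

end PartialAlgebra


/-! ### Pushouts of functors and colimits -/

section PushoutFunctor

variable {A B J : Type*} [Category* A] [Category* B] [Category* J]

/-- If three functors send a cocone to a colimit cocone, then so does their pushout. -/
lemma isColimit_mapCocone_of_isPushout [HasPushouts B] {G₁ G₂ G₃ G₄ : A ⥤ B}
    {f₂ : G₁ ⟶ G₂} {f₃ : G₁ ⟶ G₃} {g₂ : G₂ ⟶ G₄} {g₃ : G₃ ⟶ G₄} (sq : IsPushout f₂ f₃ g₂ g₃)
    {F : J ⥤ A} {c : Cocone F} (h₁ : IsColimit (G₁.mapCocone c))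
    (h₂ : IsColimit (G₂.mapCocone c)) (h₃ : IsColimit (G₃.mapCocone c)) :
    Nonempty (IsColimit (G₄.mapCocone c)) := by
  have sq' (X : A) : IsPushout (f₂.app X) (f₃.app X) (g₂.app X) (g₃.app X) :=
    sq.map ((evaluation A B).obj X)
  let s₂ (s : Cocone (F ⋙ G₄)) : Cocone (F ⋙ G₂) :=
    (Cocone.precompose (Functor.whiskerLeft F g₂)).obj s
  let s₃ (s : Cocone (F ⋙ G₄)) : Cocone (F ⋙ G₃) :=
    (Cocone.precompose (Functor.whiskerLeft F g₃)).obj s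
  have fac₂ (s : Cocone (F ⋙ G₄)) (j : J) :
      G₂.map (c.ι.app j) ≫ h₂.desc (s₂ s) = g₂.app (F.obj j) ≫ s.ι.app j := h₂.fac (s₂ s) j
  have fac₃ (s : Cocone (F ⋙ G₄)) (j : J) :
      G₃.map (c.ι.app j) ≫ h₃.desc (s₃ s) = g₃.app (F.obj j) ≫ s.ι.app j := h₃.fac (s₃ s) j
  have w (s : Cocone (F ⋙ G₄)) :
      f₂.app c.pt ≫ h₂.desc (s₂ s) = f₃.app c.pt ≫ h₃.desc (s₃ s) := h₁.hom_ext fun j => by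
    change G₁.map (c.ι.app j) ≫ _ = G₁.map (c.ι.app j) ≫ _
    have e₂ : G₁.map (c.ι.app j) ≫ f₂.app c.pt = f₂.app (F.obj j) ≫ G₂.map (c.ι.app j) :=
      f₂.naturality _
    have e₃ : G₁.map (c.ι.app j) ≫ f₃.app c.pt = f₃.app (F.obj j) ≫ G₃.map (c.ι.app j) :=
      f₃.naturality _
    rw [reassoc_of% e₂, reassoc_of% e₃, fac₂, fac₃, ← Category.assoc, ← Category.assoc,
      (sq' (F.obj j)).w]
  have n₂ (j : J) : g₂.app (F.obj j) ≫ G₄.map (c.ι.app j) = G₂.map (c.ι.app j) ≫ g₂.app c.pt :=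
    (g₂.naturality _).symm
  have n₃ (j : J) : g₃.app (F.obj j) ≫ G₄.map (c.ι.app j) = G₃.map (c.ι.app j) ≫ g₃.app c.pt :=
    (g₃.naturality _).symm
  exact ⟨{
    desc s := (sq' c.pt).desc (h₂.desc (s₂ s)) (h₃.desc (s₃ s)) (w s)
    fac s j := by
      change G₄.map (c.ι.app j) ≫ _ = _
      apply (sq' (F.obj j)).hom_ext
      · rw [reassoc_of% n₂, IsPushout.inl_desc, fac₂]
      · rw [reassoc_of% n₃, IsPushout.inr_desc, fac₃]
    uniq s m hm := by
      have hm' (j : J) : G₄.map (c.ι.app j) ≫ m = s.ι.app j := hm j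
      apply (sq' c.pt).hom_ext
      · rw [IsPushout.inl_desc]
        refine h₂.hom_ext fun j => ?_
        change G₂.map (c.ι.app j) ≫ _ = G₂.map (c.ι.app j) ≫ _
        rw [fac₂, ← reassoc_of% n₂, hm']
      · rw [IsPushout.inr_desc]
        refine h₃.hom_ext fun j => ?_
        change G₃.map (c.ι.app j) ≫ _ = G₃.map (c.ι.app j) ≫ _
        rw [fac₃, ← reassoc_of% n₃, hm'] }⟩

end PushoutFunctor

/-! ### Factorization systems on slice categories -/

section Over

variable {C : Type u} [Category.{w} C] {E M : MorphismProperty C}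

lemma IsOrthogonalFactorizationSystem.over (h : IsOrthogonalFactorizationSystem E M) (Y : C) :
    IsOrthogonalFactorizationSystem (E.inverseImage (Over.forget Y))
      (M.inverseImage (Over.forget Y)) where
  isWeakFactorizationSystem := by
    have := h.isWeakFactorizationSystem
    have : E.IsStableUnderRetracts := by
      rw [← MorphismProperty.llp_eq_of_wfs E M]
      infer_instance
    have : M.IsStableUnderRetracts := by
      rw [← MorphismProperty.rlp_eq_of_wfs E M]
      infer_instance
    have : MorphismProperty.HasFactorization (E.inverseImage (Over.forget Y))
        (M.inverseImage (Over.forget Y)) := ⟨fun {U V} f => by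
      let φ := MorphismProperty.factorizationData E M f.left
      exact ⟨{
        Z := Over.mk (φ.p ≫ V.hom)
        i := Over.homMk φ.i (by simp)
        p := Over.homMk φ.p
        fac := by ext; simp
        hi := φ.hi
        hp := φ.hp }⟩⟩
    refine MorphismProperty.IsWeakFactorizationSystem.mk' _ _ fun {A B U V} e m he hm =>
      ⟨fun {u v} sq => ?_⟩
    obtain ⟨l, hl, hl'⟩ := h.exists_lift (e := e.left) (m := m.left) he hm congr($(sq.w).left)
    exact ⟨⟨Over.homMk l (by rw [← Over.w m, ← Over.w v, reassoc_of% hl']), by ext; exact hl,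
      by ext; exact hl'⟩⟩
  unique_lift {_ _ _ _ _ _} he hm {_ _} h₁ h₂ := by
    ext
    exact h.unique_lift he hm congr($(h₁).left) congr($(h₂).left)

/-- A quotient in the slice is a quotient in `C` with a map to `Y`, and there is only a set of such
maps. -/
lemma IsWellCopowered.over (h : IsWellCopowered E) (Y : C) :
    IsWellCopowered (E.inverseImage (Over.forget Y)) := by
  intro X
  obtain ⟨ι, Q, q, hq⟩ := h X.left
  refine ⟨Σ i, { g : Q i ⟶ Y // q i ≫ g = X.hom }, fun i => Over.mk i.2.1,
    fun i => Over.homMk (q i.1) i.2.2, fun Z e he => ?_⟩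
  obtain ⟨i, φ, hφ⟩ := hq Z.left e.left he
  exact ⟨⟨i, φ.hom ≫ Z.hom, by rw [reassoc_of% hφ, Over.w]⟩, Over.isoMk φ, by ext; exact hφ⟩

end Over

/-! ### Functoriality of cylinders and path objects -/

section Cylinder

open unitInterval

variable {P : ObjectProperty TopCat.{w}} [ConvenientSpaces P]
  {C : Type u} [Category.{w} C] [TopologicallyBicomplete P C]

/-- The map out of the cylinder given by a path. -/
def cylDesc {X Y : C} {γ : I → (X ⟶ Y)} (hγ : IsPath P γ) : cyl P X ⟶ Y :=
  (exists_cyl_desc hγ).choose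

@[simp]
lemma cylIncl_cylDesc {X Y : C} {γ : I → (X ⟶ Y)} (hγ : IsPath P γ) (t : I) :
    cylIncl P t X ≫ cylDesc hγ = γ t :=
  (exists_cyl_desc hγ).choose_spec t

lemma cylIncl_cylDesc_assoc {X Y Z : C} {γ : I → (X ⟶ Y)} (hγ : IsPath P γ) (t : I) (g : Y ⟶ Z) :
    cylIncl P t X ≫ cylDesc hγ ≫ g = γ t ≫ g := by
  rw [← Category.assoc, cylIncl_cylDesc]

/-- The map into the path object given by a path. -/
def pathLift {X Y : C} {γ : I → (X ⟶ Y)} (hγ : IsPath P γ) : X ⟶ pathObj P Y :=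
  (exists_pathObj_lift hγ).choose

@[simp]
lemma pathLift_pathEval {X Y : C} {γ : I → (X ⟶ Y)} (hγ : IsPath P γ) (t : I) :
    pathLift hγ ≫ pathEval P t Y = γ t :=
  (exists_pathObj_lift hγ).choose_spec t

lemma pathLift_pathEval_assoc {X Y Z : C} {γ : I → (X ⟶ Y)} (hγ : IsPath P γ) (t : I)
    (g : Y ⟶ Z) : pathLift hγ ≫ pathEval P t Y ≫ g = γ t ≫ g := by
  rw [← Category.assoc, pathLift_pathEval]

variable (P C)

/-- The cylinder functor. -/
def cylFunctor : C ⥤ C where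
  obj X := cyl P X
  map {X Y} f := cylDesc ((isPath_cylIncl (P := P) Y).precomp f)
  map_id X := Tensor.hom_ext fun t => by simp
  map_comp f g := Tensor.hom_ext fun t => by simp [cylIncl_cylDesc_assoc]

/-- The path object functor. -/
def pathFunctor : C ⥤ C where
  obj X := pathObj P X
  map {X Y} f := pathLift ((isPath_pathEval (P := P) X).postcomp f)
  map_id X := Cotensor.hom_ext fun t => by simp
  map_comp f g := Cotensor.hom_ext fun t => by simp [pathLift_pathEval_assoc]

variable {C} in
/-- Maps out of the cylinder correspond to maps into the path object. -/
def cylEquiv (X Y : C) : (cyl P X ⟶ Y) ≃ (X ⟶ pathObj P Y) where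
  toFun f := pathLift ((isPath_cylIncl (P := P) X).postcomp f)
  invFun g := cylDesc ((isPath_pathEval (P := P) Y).precomp g)
  left_inv f := Tensor.hom_ext fun t => by simp
  right_inv g := Cotensor.hom_ext fun t => by simp

variable {C} in
@[simp]
lemma cylEquiv_pathEval {X Y : C} (f : cyl P X ⟶ Y) (t : I) :
    cylEquiv P X Y f ≫ pathEval P t Y = cylIncl P t X ≫ f :=
  pathLift_pathEval ((isPath_cylIncl (P := P) X).postcomp f) t

variable {C} in
@[simp]
lemma cylIncl_cylEquiv_symm {X Y : C} (g : X ⟶ pathObj P Y) (t : I) :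
    cylIncl P t X ≫ (cylEquiv P X Y).symm g = g ≫ pathEval P t Y :=
  cylIncl_cylDesc ((isPath_pathEval (P := P) Y).precomp g) t

/-- The adjunction between cylinders and path objects. -/
def cylAdjunction : cylFunctor P C ⊣ pathFunctor P C :=
  Adjunction.mkOfHomEquiv {
    homEquiv X Y := cylEquiv P X Y
    homEquiv_naturality_left_symm f g := Tensor.hom_ext fun t =>
      (cylIncl_cylEquiv_symm P _ t).trans ((Category.assoc _ _ _).trans
        ((congr(f ≫ $(cylIncl_cylEquiv_symm P g t)).symm.trans (Category.assoc _ _ _).symm).trans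
          (congr($(cylIncl_cylDesc ((isPath_cylIncl (P := P) _).precomp f) t) ≫ _).symm.trans
            (Category.assoc _ _ _))))
    homEquiv_naturality_right f g := Cotensor.hom_ext fun t =>
      (cylEquiv_pathEval P _ t).trans ((Category.assoc _ _ _).symm.trans
        ((congr($(cylEquiv_pathEval P f t) ≫ g).symm.trans (Category.assoc _ _ _)).trans
          (congr(_ ≫ $(pathLift_pathEval ((isPath_pathEval (P := P) _).postcomp g) t)).symm.trans
            (Category.assoc _ _ _).symm))) }

end Cylinder

/-! ### The pointed endofunctor whose algebras are the `h`-fibrations -/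

section Endofunctor

open unitInterval

variable (P : ObjectProperty TopCat.{w}) [ConvenientSpaces P]
  {C : Type u} [Category.{w} C] [TopologicallyBicomplete P C] (Y : C)

/-- The first projection from the mapping path object. -/
def mappingPathFst : mappingPath P Y ⟶ Over.forget Y where
  app f := pullback.fst f.hom (pathEval P 0 Y)
  naturality _ _ _ := pullback.lift_fst _ _ _

/-- The tautological path of maps from the mapping path object. -/
def mappingPathEval (f : Over Y) (t : I) : (mappingPath P Y).obj f ⟶ Y :=
  (pullback.snd f.hom (pathEval P 0 Y)) ≫ pathEval P t Y

variable {P Y} in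
@[simp]
lemma mappingPath_map_eval {f g : Over Y} (k : f ⟶ g) (t : I) :
    (mappingPath P Y).map k ≫ mappingPathEval P Y g t = mappingPathEval P Y f t :=
  pullback.lift_snd_assoc _ _ _ _

variable {P Y} in
lemma mappingPath_map_fst {f g : Over Y} (k : f ⟶ g) :
    (mappingPath P Y).map k ≫ (mappingPathFst P Y).app g = (mappingPathFst P Y).app f ≫ k.left :=
  (mappingPathFst P Y).naturality k

lemma isPath_mappingPathEval (f : Over Y) : IsPath P (mappingPathEval P Y f) :=
  isPath_mapPath f.hom

lemma mappingPathEval_zero (f : Over Y) :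
    mappingPathEval P Y f 0 = (mappingPathFst P Y).app f ≫ f.hom :=
  pullback.condition.symm

/-- The mapping path object functor, with values over `Y` via `p₀`. -/
def pathOver : Over Y ⥤ Over Y :=
  Over.lift (mappingPath P Y) (mappingPathFst P Y ≫ (Over.forgetCocone Y).ι)

/-- The cylinder on the mapping path object, over `Y` via the tautological homotopy. -/
def cylOver : Over Y ⥤ Over Y :=
  Over.lift (mappingPath P Y ⋙ cylFunctor P C)
    { app f := cylDesc (isPath_mappingPathEval P Y f)
      naturality f g k := Tensor.hom_ext fun t =>
        (cylIncl_cylDesc_assoc ((isPath_cylIncl (P := P) _).precomp ((mappingPath P Y).map k)) t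
          (cylDesc (isPath_mappingPathEval P Y g))).trans <| by
        simp only [Category.assoc, cylIncl_cylDesc, mappingPath_map_eval]
        exact (cylIncl_cylDesc (isPath_mappingPathEval P Y f) t).symm.trans
          congr(_ ≫ $((Category.comp_id _).symm)) }

/-- The projection of the mapping path object. -/
def pathOverFst : pathOver P Y ⟶ 𝟭 (Over Y) where
  app f := Over.homMk ((mappingPathFst P Y).app f) rfl
  naturality f g k := by
    ext
    exact mappingPath_map_fst k

/-- The inclusion of the mapping path object in its cylinder. -/
def pathOverIncl : pathOver P Y ⟶ cylOver P Y where
  app f := Over.homMk (cylIncl P 0 _)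
    ((cylIncl_cylDesc (isPath_mappingPathEval P Y f) 0).trans (mappingPathEval_zero P Y f))
  naturality f g k := by
    ext
    exact (cylIncl_cylDesc ((isPath_cylIncl (P := P) _).precomp ((mappingPath P Y).map k)) 0).symm

/-- The endofunctor of `Over Y` that freely adds solutions to the universal lifting problem. -/
def liftingFunctor : Over Y ⥤ Over Y := pushout (pathOverFst P Y) (pathOverIncl P Y)

/-- The point of `liftingFunctor`. -/
def liftingPoint : 𝟭 (Over Y) ⟶ liftingFunctor P Y := pushout.inl _ _

/-- The universal lifting. -/
def liftingUniv : cylOver P Y ⟶ liftingFunctor P Y := pushout.inr _ _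

lemma isPushout_liftingFunctor :
    IsPushout (pathOverFst P Y) (pathOverIncl P Y) (liftingPoint P Y) (liftingUniv P Y) :=
  IsPushout.of_hasPushout _ _

lemma isPushout_liftingFunctor_app (f : Over Y) :
    IsPushout ((pathOverFst P Y).app f) ((pathOverIncl P Y).app f) ((liftingPoint P Y).app f)
      ((liftingUniv P Y).app f) :=
  (isPushout_liftingFunctor P Y).map ((evaluation _ _).obj f)

variable {P Y} in
-- The cylinder is a left adjoint, colimits over `Y` are detected in `C`, and pushouts commute with
-- colimits, so `N` is the only obstruction.
lemma isColimit_liftingFunctor {J : Type w} [Category.{w} J] {F : J ⥤ Over Y} {c : Cocone F}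
    (hc : IsColimit c) (h : IsColimit ((mappingPath P Y).mapCocone c)) :
    Nonempty (IsColimit ((liftingFunctor P Y).mapCocone c)) := by
  have : (cylFunctor P C).IsLeftAdjoint := (cylAdjunction P C).isLeftAdjoint
  have h₁ : IsColimit ((Over.forget Y).mapCocone ((pathOver P Y).mapCocone c)) := h
  have h₃ : IsColimit ((Over.forget Y).mapCocone ((cylOver P Y).mapCocone c)) :=
    isColimitOfPreserves (cylFunctor P C) h
  exact isColimit_mapCocone_of_isPushout (isPushout_liftingFunctor P Y)
    (isColimitOfReflects (Over.forget Y) h₁) hc (isColimitOfReflects (Over.forget Y) h₃)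

variable {P Y} in
/-- The path lifting function of an algebra. -/
def algebraLift {A : Over Y} (a : (liftingFunctor P Y).obj A ⟶ A) (t : I) :
    (mappingPath P Y).obj A ⟶ A.left :=
  cylIncl P t _ ≫ ((liftingUniv P Y).app A ≫ a).left

variable {P Y} in
-- The initial condition is the commutativity of the pushout square together with the unit law; the
-- lifting condition says that the algebra map lives over `Y`.
lemma isPathLifting_algebraLift {A : Over Y} {a : (liftingFunctor P Y).obj A ⟶ A}
    (ha : (liftingPoint P Y).app A ≫ a = 𝟙 A) : IsPathLifting A.hom (algebraLift a) where
  isPath := (isPath_cylIncl _).postcomp _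
  zero := by
    have := (isPushout_liftingFunctor_app P Y A).w
    have h : (pathOverIncl P Y).app A ≫ (liftingUniv P Y).app A ≫ a = (pathOverFst P Y).app A := by
      rw [← Category.assoc, ← this, Category.assoc, ha]
      exact Category.comp_id _
    exact congr($(h).left)
  comp t := by
    have h := Over.w ((liftingUniv P Y).app A ≫ a)
    exact (Category.assoc _ _ _).trans (congr(cylIncl P t _ ≫ $h).trans
      (cylIncl_cylDesc (isPath_mappingPathEval P Y A) t))

variable {P Y} in
/-- A map with a solution of the universal lifting problem is an algebra. -/
lemma exists_algebra {W : Over Y} {δ : I → ((mappingPath P Y).obj W ⟶ W.left)}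
    (hδ : IsPath P δ) (h₀ : δ 0 = (mappingPathFst P Y).app W)
    (h : ∀ t, δ t ≫ W.hom = mappingPathEval P Y W t) :
    ∃ w : (liftingFunctor P Y).obj W ⟶ W, (liftingPoint P Y).app W ≫ w = 𝟙 W ∧
      ((liftingUniv P Y).app W ≫ w).left = cylDesc hδ := by
  let k : (cylOver P Y).obj W ⟶ W := Over.homMk (cylDesc hδ) (Tensor.hom_ext fun t =>
    (Category.assoc _ _ _).symm.trans (congr($(cylIncl_cylDesc hδ t) ≫ W.hom).trans
      ((h t).trans (cylIncl_cylDesc (isPath_mappingPathEval P Y W) t).symm)))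
  have hk : (pathOverFst P Y).app W ≫ 𝟙 W = (pathOverIncl P Y).app W ≫ k := by
    ext
    exact (Category.comp_id _).trans (h₀.symm.trans (cylIncl_cylDesc hδ 0).symm)
  have sq := isPushout_liftingFunctor_app P Y W
  have hr : (liftingUniv P Y).app W ≫ sq.desc (𝟙 W) k hk = k := sq.inr_desc _ _ _
  exact ⟨sq.desc (𝟙 W) k hk, sq.inl_desc _ _ _, congr(Over.Hom.left $hr)⟩

variable {P Y} in
lemma algebra_hom_ext {W A : Over Y} {f g : (liftingFunctor P Y).obj W ⟶ A}
    (h₁ : (liftingPoint P Y).app W ≫ f = (liftingPoint P Y).app W ≫ g)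
    (h₂ : ∀ t, cylIncl P t _ ≫ ((liftingUniv P Y).app W ≫ f).left =
      cylIncl P t _ ≫ ((liftingUniv P Y).app W ≫ g).left) : f = g := by
  apply (isPushout_liftingFunctor_app P Y W).hom_ext h₁
  ext
  exact Tensor.hom_ext h₂

variable {P Y} in
/-- An `h`-fibration over an algebra carries an algebra structure for which it is a morphism of
algebras. -/
lemma exists_algebra_of_hFibrations {A : Over Y} {a : (liftingFunctor P Y).obj A ⟶ A}
    (ha : (liftingPoint P Y).app A ≫ a = 𝟙 A) {W : Over Y} (q : W ⟶ A)
    (hq : hFibrations P C q.left) :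
    ∃ w : (liftingFunctor P Y).obj W ⟶ W, (liftingPoint P Y).app W ≫ w = 𝟙 W ∧
      (liftingFunctor P Y).map q ≫ a = w ≫ q := by
  have hl := isPathLifting_algebraLift ha
  have hl₀ : algebraLift a 0 = (mappingPathFst P Y).app A := hl.zero
  have hlc (t : I) : algebraLift a t ≫ A.hom = mappingPathEval P Y A t := hl.comp t
  -- Lifting through `q` the path lifting function of `A`, restricted to `N W`, gives one on `W`
  -- that `q` respects.
  obtain ⟨δ, hδ, δ₀, δq⟩ := (hFibrations_iff q.left).1 hq ((mappingPathFst P Y).app W)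
    (fun t => (mappingPath P Y).map q ≫ algebraLift a t) (hl.isPath.precomp _) (by
      rw [hl₀]
      exact mappingPath_map_fst q)
  obtain ⟨w, hw, hw'⟩ := exists_algebra hδ δ₀ fun t => by
    rw [← Over.w q, reassoc_of% (δq t), hlc, mappingPath_map_eval]
  refine ⟨w, hw, algebra_hom_ext ?_ fun t => ?_⟩
  · have := (liftingPoint P Y).naturality q
    rw [← Category.assoc, ← this, Category.assoc, ha, reassoc_of% hw]
    exact Category.comp_id q
  · have h₁ : (liftingUniv P Y).app W ≫ (liftingFunctor P Y).map q ≫ a =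
        (cylOver P Y).map q ≫ (liftingUniv P Y).app A ≫ a := by
      rw [← Category.assoc, ← NatTrans.naturality, Category.assoc]
    have h₂ : ((liftingUniv P Y).app W ≫ w ≫ q).left = cylDesc hδ ≫ q.left := by
      rw [← hw']
      exact (Category.assoc _ _ _).symm
    have h₃ : ((cylOver P Y).map q ≫ (liftingUniv P Y).app A ≫ a).left =
        cylDesc ((isPath_cylIncl (P := P) _).precomp ((mappingPath P Y).map q)) ≫
          ((liftingUniv P Y).app A ≫ a).left := rfl
    rw [h₁, h₂, h₃]
    exact (cylIncl_cylDesc_assoc ((isPath_cylIncl (P := P) _).precomp ((mappingPath P Y).map q))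
      t _).trans ((Category.assoc _ _ _).trans ((δq t).symm.trans
        (cylIncl_cylDesc_assoc hδ t q.left).symm))

end Endofunctor

/-! ### The main theorem -/

open MorphismProperty in
-- The right factor of `f` is the free algebra on `f` over `Y`. To lift the left factor against an
-- `h`-fibration `p`, pull `p` back to the free algebra; the pullback is an algebra, and freeness
-- gives a section extending the given map on `X`.
lemma hasFactorization_of_monomorphismHypothesis (P : ObjectProperty TopCat.{w})
    [ConvenientSpaces P] (C : Type u) [Category.{w} C] [TopologicallyBicomplete P C]
    (hC : MonomorphismHypothesis P C) :
    HasFactorization (hFibrations P C).llp (hFibrations P C) where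
  nonempty_mapFactorizationData {X Y} f := by
    obtain ⟨E, M, h, hE, α, hα, hN⟩ := hC
    obtain ⟨A, x, a, ha, hfree⟩ := PartialAlgebra.exists_free_algebra (liftingPoint P Y)
      (h.over Y) (hE.over Y) hα (fun F c hc hM =>
        isColimit_liftingFunctor hc (hN Y F c hc hM).some) (Over.mk f)
    refine ⟨{
      Z := A.left
      i := x.left
      p := A.hom
      fac := Over.w x
      hi := fun U V p hp => ⟨fun {u v} sq => ?_⟩
      hp := (hFibrations_iff_exists_isPathLifting _).2 ⟨_, isPathLifting_algebraLift ha⟩ }⟩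
    let q : Over.mk (pullback.fst v p ≫ A.hom) ⟶ A := Over.homMk (pullback.fst v p)
    have hq : hFibrations P C q.left := MorphismProperty.pullback_fst _ _ hp
    obtain ⟨w, hw, hwq⟩ := exists_algebra_of_hFibrations ha q hq
    obtain ⟨l, hl, hl'⟩ := hfree w hw q hwq
      (Over.homMk (pullback.lift x.left u sq.w.symm)
        ((pullback.lift_fst_assoc _ _ _ _).trans (Over.w x)))
      (by ext; exact pullback.lift_fst _ _ _)
    have e₁ : x.left ≫ l.left = pullback.lift x.left u sq.w.symm := congr($(hl).left)
    have e₂ : l.left ≫ pullback.fst v p = 𝟙 _ := congr($(hl').left)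
    refine ⟨⟨l.left ≫ pullback.snd v p, ?_, ?_⟩⟩
    · rw [reassoc_of% e₁, pullback.lift_snd]
    · rw [Category.assoc, ← pullback.condition, reassoc_of% e₂]

end HurewiczModel
end

theorem mainTheorem3 (P : ObjectProperty TopCat.{w}) [ConvenientSpaces P]
    (C : Type u) [Category.{w} C] [TopologicallyBicomplete P C]
    (hC : MonomorphismHypothesis P C) :
    ∃ _ : ModelCategory C,
      weakEquivalences C = homotopyEquivalences P C ∧
      fibrations C = hFibrations P C ∧
      cofibrations C = strongHCofibrations P C := by
  have := hasFactorization_of_monomorphismHypothesis P C hC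
  exact exists_modelCategory P C
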